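/- Let $d\ge 3$ and $N\ge 1$ be integers, let $p=\frac{2d}{d-2}$, and let $G:\mathbb{R}^N\to\mathbb{R}$ be a continuous function such that (1) $G(0)=0$ and $G(a)>0$ for all $a\in\mathbb{R}^N\setminus\{0\}$; (2) $\lim_{|a|\to 0}|a|^{-p}G(a)=0=\lim_{|a|\to\infty}|a|^{-p}G(a)$; (3) for every $\delta>0$ there exists $C_\delta>0$ such that $|G(a+b)-G(a)|\le\delta|a|^p+C_\delta|b|^p$ for all $a,b\in\mathbb{R}^N$. Let $\dot H^1(\mathbb{R}^d,\mathbb{R}^N)$ denote the homogeneous Sobolev space, that is, the completion of $C_c^\infty(\mathbb{R}^d,\mathbb{R}^N)$ for the norm $\|\nabla u\|_{L^2}=\big(\sum_{i=1}^d\int_{\mathbb{R}^d}|\partial_i u(x)|^2\,dx\big)^{1/2}$, realized as a space of locally integrable functions with weak gradient in $L^2$. Let $\mathcal{C}=\{u\in\dot H^1(\mathbb{R}^d,\mathbb{R}^N): G(u)\in L^1(\mathbb{R}^d)\}$ and $$\mathcal{S}=\sup\Big\{\int_{\mathbb{R}^d}G(u(x))\,dx\ :\ u\in\mathcal{C},\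 \|\nabla u\|_{L^2}=1\Big\}.$$ Then there exists $u\in\mathcal{C}$ with $\|\nabla u\|_{L^2}=1$ such that $\int_{\mathbb{R}^d}G(u(x))\,dx=\mathcal{S}$ (in particular $\mathcal{S}<\infty$). -/

import Mathlib

open MeasureTheory Filter Topology
open scoped ContDiff

/-- The `i`-th (classical) partial derivative of `f : ℝ^d → F`. -/
noncomputable def pderiv {d : ℕ} {F : Type*} [NormedAddCommGroup F] [NormedSpace ℝ F]
    (i : Fin d) (f : EuclideanSpace ℝ (Fin d) → F) (x : EuclideanSpace ℝ (Fin d)) : F :=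
  fderiv ℝ f x (EuclideanSpace.single i (1 : ℝ))

/-- `g = (g 0, …, g (d - 1))` is the weak (distributional) gradient of the locally integrable
map `u : ℝ^d → ℝ^N`, where `g i` is the weak partial derivative in the direction `i`. -/
structure HasWeakGradient {d N : ℕ}
    (u : EuclideanSpace ℝ (Fin d) → EuclideanSpace ℝ (Fin N))
    (g : Fin d → EuclideanSpace ℝ (Fin d) → EuclideanSpace ℝ (Fin N)) : Prop where
  locallyIntegrable : LocallyIntegrable u volume
  locallyIntegrable_grad : ∀ i, LocallyIntegrable (g i) volume
  integral_eq : ∀ (i : Fin d) (η : EuclideanSpace ℝ (Fin d) → ℝ),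
    ContDiff ℝ ∞ η → HasCompactSupport η →
      ∫ x, η x • g i x = -∫ x, pderiv i η x • u x

/-- `u` belongs to the homogeneous Sobolev space `Ḣ¹(ℝ^d, ℝ^N)` (for `d ≥ 3`) and has weak gradient
`g`: the gradient is square integrable, and `u` lies in the completion of the smooth compactly
supported maps for the norm `‖∇φ‖_{L²}`, realized as a space of locally integrable functions. -/
structure MemHomogeneousSobolev {d N : ℕ}
    (u : EuclideanSpace ℝ (Fin d) → EuclideanSpace ℝ (Fin N))
    (g : Fin d → EuclideanSpace ℝ (Fin d) → EuclideanSpace ℝ (Fin N)) : Prop where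
  hasWeakGradient : HasWeakGradient u g
  memLp_grad : ∀ i, MemLp (g i) 2 volume
  exists_approx : ∃ φ : ℕ → EuclideanSpace ℝ (Fin d) → EuclideanSpace ℝ (Fin N),
    (∀ n, ContDiff ℝ ∞ (φ n)) ∧ (∀ n, HasCompactSupport (φ n)) ∧
    (∀ i, Tendsto (fun n => eLpNorm (fun x => pderiv i (φ n) x - g i x) 2 volume) atTop (𝓝 0)) ∧
    (∀ K : Set (EuclideanSpace ℝ (Fin d)), IsCompact K →
      Tendsto (fun n => eLpNorm (fun x => φ n x - u x) 1 (volume.restrict K)) atTop (𝓝 0))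

/-- The norm `‖∇u‖_{L²} = (∑ᵢ ∫ |∂ᵢu|²)^{1/2}` of a square integrable gradient `g = ∇u`. -/
noncomputable def gradNorm {d N : ℕ}
    (g : Fin d → EuclideanSpace ℝ (Fin d) → EuclideanSpace ℝ (Fin N)) : ℝ :=
  Real.sqrt (∑ i, ∫ x, ‖g i x‖ ^ 2)

/-- The constraint set: maps `u ∈ Ḣ¹(ℝ^d, ℝ^N)` with `G(u) ∈ L¹(ℝ^d)` and `‖∇u‖_{L²} = 1`. -/
def constraintSet (d : ℕ) {N : ℕ} (G : EuclideanSpace ℝ (Fin N) → ℝ) :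
    Set (EuclideanSpace ℝ (Fin d) → EuclideanSpace ℝ (Fin N)) :=
  {u | Integrable (fun x => G (u x)) volume ∧
    ∃ g, MemHomogeneousSobolev u g ∧ gradNorm g = 1}

/-- The supremum of `∫ G(u)` over the constraint set, as an extended real number. -/
noncomputable def supValue (d : ℕ) {N : ℕ} (G : EuclideanSpace ℝ (Fin N) → ℝ) : EReal :=
  ⨆ u ∈ constraintSet d G, ((∫ x, G (u x) : ℝ) : EReal)

/-- The critical Sobolev exponent `2d/(d-2)`. -/
noncomputable def critExp (d : ℕ) : ℝ := 2 * (d : ℝ) / ((d : ℝ) - 2)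

/-! A maximizing sequence is shown to have a nonzero weak limit, and strict superlinearity of the
scaling exponent forces that limit to carry all of the gradient norm.

Scaling: replacing `u` by `u(r ·)` multiplies `‖∇u‖²` by `r^(2-d)` and the energy `∫ G(u)` by
`r^(-d)`. Hence the energy is at most `S ‖∇u‖^p` for every `u`, where `p = critExp d > 2` and `S` is
the supremum over normalized maps (`integral_comp_le_testSup`, `energy_sobEmb_le`).

Nonvanishing: since `G` is subcritical at `0` and at infinity, it is bounded by a small multiple of
`|a|^p` plus a constant on `{|a| > c}`. An energy bounded below therefore forces `|u| > c` on a set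
of volume bounded below. As `u` differs from its average over balls of radius `ε` by `O(ε)` in `L²`,
some such average is at least `c/2` in norm (`exists_ballAvg_lower_bound`). Translating that ball to
the origin makes the weak limit `h` nonzero.

Splitting: put `m = ‖h‖²`, so `0 < m ≤ 1`. Weak convergence gives `‖x n - h‖² → 1 - m`, and the
Brezis–Lieb splitting (`tendsto_energy_sub_energy_sub`) gives `S ≤ S (m^(p/2) + (1-m)^(p/2))`. As `S
> 0` and `p/2 > 1`, this requires `m = 1`, and then `h` has energy `S`.

The space `Ḣ¹` is handled as the Hilbert space `hdot` of `L²` limits of gradients of test maps;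
`sobEmb` recovers the function from its gradient. -/

/-- The Euclidean space of dimension `n`. -/
abbrev Space (n : ℕ) := EuclideanSpace ℝ (Fin n)

/-- The Lebesgue exponent `2d/(d-2)` as an extended nonnegative real. -/
noncomputable def sobExp (d : ℕ) : ENNReal := ENNReal.ofReal (critExp d)

/-! ### The critical exponent -/

section Exponent

variable {d : ℕ}

lemma two_lt_critExp (hd : 3 ≤ d) : 2 < critExp d := by
  have h : (3 : ℝ) ≤ d := by exact_mod_cast hd
  rw [critExp, lt_div_iff₀ (by linarith)]
  linarith

lemma critExp_pos (hd : 3 ≤ d) : 0 < critExp d := by linarith [two_lt_critExp hd]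

lemma sobExp_toReal (hd : 3 ≤ d) : (sobExp d).toReal = critExp d :=
  ENNReal.toReal_ofReal (critExp_pos hd).le

lemma sobExp_ne_top : sobExp d ≠ ⊤ := ENNReal.ofReal_ne_top

lemma one_le_sobExp (hd : 3 ≤ d) : 1 ≤ sobExp d := by
  rw [sobExp, ENNReal.one_le_ofReal]
  linarith [two_lt_critExp hd]

lemma sobExp_ne_zero (hd : 3 ≤ d) : sobExp d ≠ 0 :=
  (zero_lt_one.trans_le (one_le_sobExp hd)).ne'

lemma inv_critExp (hd : 3 ≤ d) : (critExp d)⁻¹ = 2⁻¹ - (d : ℝ)⁻¹ := by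
  have h : (3 : ℝ) ≤ d := by exact_mod_cast hd
  have h2 : (d : ℝ) - 2 ≠ 0 := by linarith
  rw [critExp]
  field_simp

end Exponent

/-! ### Test maps, their gradients and the Sobolev inequality -/

/-- The space of smooth compactly supported maps. -/
def testFn (d N : ℕ) : Submodule ℝ (Space d → Space N) where
  carrier := {f | ContDiff ℝ ∞ f ∧ HasCompactSupport f}
  zero_mem' := ⟨contDiff_const, HasCompactSupport.zero⟩
  add_mem' hf hg := ⟨hf.1.add hg.1, hf.2.add hg.2⟩
  smul_mem' c _ hf := ⟨contDiff_const.smul hf.1, hf.2.smul_left (f := fun _ => c)⟩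

/-- Smooth compactly supported maps. -/
abbrev TestMap (d N : ℕ) : Type := testFn d N

section Test

variable {d N : ℕ}

lemma TestMap.contDiff (φ : TestMap d N) : ContDiff ℝ ∞ φ.1 := φ.2.1

lemma TestMap.hasCompactSupport (φ : TestMap d N) : HasCompactSupport φ.1 := φ.2.2

lemma TestMap.differentiable (φ : TestMap d N) : Differentiable ℝ φ.1 :=
  φ.contDiff.differentiable (by simp)

lemma TestMap.memLp (φ : TestMap d N) (p : ENNReal) : MemLp φ.1 p volume :=
  φ.contDiff.continuous.memLp_of_hasCompactSupport φ.hasCompactSupport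

lemma TestMap.continuous_fderiv (φ : TestMap d N) : Continuous (fderiv ℝ φ.1) :=
  φ.contDiff.continuous_fderiv (by simp)

lemma TestMap.continuous_pderiv (φ : TestMap d N) (i : Fin d) : Continuous (pderiv i φ.1) :=
  φ.continuous_fderiv.clm_apply continuous_const

lemma TestMap.hasCompactSupport_pderiv (φ : TestMap d N) (i : Fin d) :
    HasCompactSupport (pderiv i φ.1) :=
  φ.hasCompactSupport.fderiv_apply ℝ _

lemma TestMap.memLp_pderiv (φ : TestMap d N) (i : Fin d) (p : ENNReal) :
    MemLp (pderiv i φ.1) p volume :=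
  (φ.continuous_pderiv i).memLp_of_hasCompactSupport (φ.hasCompactSupport_pderiv i)

lemma pderiv_add (i : Fin d) (φ ψ : TestMap d N) :
    pderiv i (φ + ψ).1 = pderiv i φ.1 + pderiv i ψ.1 := by
  funext x
  simp only [pderiv, Submodule.coe_add, Pi.add_apply]
  rw [fderiv_add (φ.differentiable x) (ψ.differentiable x), add_apply]

lemma pderiv_smul (i : Fin d) (c : ℝ) (φ : TestMap d N) :
    pderiv i (c • φ).1 = c • pderiv i φ.1 := by
  funext x
  simp only [pderiv, Submodule.coe_smul, Pi.smul_apply]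
  rw [fderiv_const_smul (φ.differentiable x), smul_apply]

/-- The space of square integrable gradients. -/
abbrev GradSpace (d N : ℕ) :=
  PiLp 2 (fun _ : Fin d => Lp (Space N) 2 (volume : Measure (Space d)))

/-- The gradient of a test map. -/
noncomputable def testGrad (d N : ℕ) : TestMap d N →ₗ[ℝ] GradSpace d N where
  toFun φ := WithLp.toLp 2 fun i => (φ.memLp_pderiv i 2).toLp _
  map_add' φ ψ := by
    ext1 i
    simp only [pderiv_add]
    exact MemLp.toLp_add (φ.memLp_pderiv i 2) (ψ.memLp_pderiv i 2)
  map_smul' c φ := by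
    ext1 i
    simp only [pderiv_smul]
    exact MemLp.toLp_const_smul c (φ.memLp_pderiv i 2)

/-- The class in `L^p` of a test map. -/
noncomputable def testToLp (d N : ℕ) (p : ENNReal) :
    TestMap d N →ₗ[ℝ] Lp (Space N) p (volume : Measure (Space d)) where
  toFun φ := (φ.memLp p).toLp _
  map_add' _ _ := MemLp.toLp_add _ _
  map_smul' _ _ := MemLp.toLp_const_smul _ _

lemma coeFn_testGrad (φ : TestMap d N) (i : Fin d) : testGrad d N φ i =ᵐ[volume] pderiv i φ.1 :=
  (φ.memLp_pderiv i 2).coeFn_toLp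

lemma coeFn_testToLp (p : ENNReal) (φ : TestMap d N) : testToLp d N p φ =ᵐ[volume] φ.1 :=
  (φ.memLp p).coeFn_toLp

lemma norm_fderiv_le_sum (u : Space d → Space N) (x : Space d) :
    ‖fderiv ℝ u x‖ ≤ ∑ i, ‖pderiv i u x‖ := by
  refine ContinuousLinearMap.opNorm_le_bound _ (by positivity) fun v => ?_
  have hv : v = ∑ i, v i • EuclideanSpace.single i (1 : ℝ) := by
    simpa using ((EuclideanSpace.basisFun (Fin d) ℝ).sum_repr v).symm
  calc ‖fderiv ℝ u x v‖ = ‖∑ i, v i • pderiv i u x‖ := by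
        conv_lhs => rw [hv]
        simp [pderiv]
    _ ≤ ∑ i, ‖v i • pderiv i u x‖ := norm_sum_le _ _
    _ ≤ ∑ i, ‖v‖ * ‖pderiv i u x‖ := by
        refine Finset.sum_le_sum fun i _ => ?_
        rw [norm_smul]
        gcongr
        exact PiLp.norm_apply_le v i
    _ = (∑ i, ‖pderiv i u x‖) * ‖v‖ := by rw [← Finset.mul_sum, mul_comm]

lemma eLpNorm_pderiv_le (φ : TestMap d N) (i : Fin d) :
    eLpNorm (pderiv i φ.1) 2 volume ≤ ENNReal.ofReal ‖testGrad d N φ‖ := by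
  have h : ‖testGrad d N φ i‖ ≤ ‖testGrad d N φ‖ := PiLp.norm_apply_le _ i
  rw [Lp.norm_def, eLpNorm_congr_ae (coeFn_testGrad φ i)] at h
  exact (ENNReal.le_ofReal_iff_toReal_le (φ.memLp_pderiv i 2).2.ne (norm_nonneg _)).2 h

lemma eLpNorm_fderiv_le (φ : TestMap d N) :
    eLpNorm (fderiv ℝ φ.1) 2 volume ≤ ENNReal.ofReal (d * ‖testGrad d N φ‖) := by
  calc eLpNorm (fderiv ℝ φ.1) 2 volume
      ≤ eLpNorm (fun x => ∑ i, ‖pderiv i φ.1 x‖) 2 volume :=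
        eLpNorm_mono_real (norm_fderiv_le_sum φ.1)
    _ = eLpNorm (∑ i, fun x => ‖pderiv i φ.1 x‖) 2 volume := by
        congr 1; funext x; simp
    _ ≤ ∑ i, eLpNorm (fun x => ‖pderiv i φ.1 x‖) 2 volume :=
        eLpNorm_sum_le (fun i _ => (φ.memLp_pderiv i 2).1.norm) (by norm_num)
    _ ≤ ∑ _i : Fin d, ENNReal.ofReal ‖testGrad d N φ‖ := by
        refine Finset.sum_le_sum fun i _ => ?_
        rw [eLpNorm_norm]
        exact eLpNorm_pderiv_le φ i
    _ = ENNReal.ofReal (d * ‖testGrad d N φ‖) := by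
        rw [ENNReal.ofReal_mul (by positivity)]
        simp

/-- The Sobolev inequality for test maps. -/
lemma exists_norm_testToLp_le (hd : 3 ≤ d) :
    ∃ C : ℝ, 0 ≤ C ∧ ∀ φ : TestMap d N, ‖testToLp d N (sobExp d) φ‖ ≤ C * ‖testGrad d N φ‖ := by
  refine ⟨eLpNormLESNormFDerivOfEqInnerConst (volume : Measure (Space d)) (2 : NNReal) * d,
    by positivity, fun φ => ?_⟩
  have h := eLpNorm_le_eLpNorm_fderiv_of_eq_inner (volume : Measure (Space d))
    (φ.contDiff.of_le (by simp)) φ.hasCompactSupport (p := 2) (p' := (critExp d).toNNReal)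
    (by norm_num) (by simp; omega)
    (by rw [Real.coe_toNNReal _ (critExp_pos hd).le, inv_critExp hd]; simp)
  rw [Lp.norm_def, eLpNorm_congr_ae (coeFn_testToLp _ φ)]
  refine ENNReal.toReal_le_of_le_ofReal (by positivity) ?_
  refine h.trans ?_
  rw [mul_assoc, ENNReal.ofReal_mul (by positivity), ENNReal.ofReal_coe_nnreal]
  gcongr
  exact eLpNorm_fderiv_le φ

end Test

/-! ### Averages over balls and their distance to the function in `L²` -/

section Average

variable {d N : ℕ}

lemma sq_lintegral_le_lintegral_sq {α : Type*} [MeasurableSpace α] (μ : Measure α)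
    [IsProbabilityMeasure μ] {f : α → ENNReal} (hf : AEMeasurable f μ) :
    (∫⁻ x, f x ∂μ) ^ 2 ≤ ∫⁻ x, f x ^ 2 ∂μ := by
  have h := ENNReal.lintegral_mul_le_Lp_mul_Lq μ Real.HolderConjugate.two_two hf
    (aemeasurable_const (b := (1 : ENNReal)))
  simp only [Pi.mul_apply, mul_one, ENNReal.one_rpow, lintegral_one, measure_univ] at h
  have h2 := pow_le_pow_left' h 2
  rw [← ENNReal.rpow_natCast, ← ENNReal.rpow_natCast, ← ENNReal.rpow_mul] at h2
  simpa using h2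

/-- Write the increment as the integral of the derivative along the segment from `x` to `x + h`,
apply Cauchy–Schwarz in `t`, then Tonelli and translation invariance. -/
lemma lintegral_sq_enorm_translate_sub_le {u : Space d → Space N} (hu : ContDiff ℝ 1 u)
    (h : Space d) :
    ∫⁻ x, ‖u (x + h) - u x‖ₑ ^ 2 ≤ ‖h‖ₑ ^ 2 * ∫⁻ x, ‖fderiv ℝ u x‖ₑ ^ 2 := by
  have hc : Continuous (fderiv ℝ u) := hu.continuous_fderiv (by simp)
  set μ : Measure ℝ := volume.restrict (Set.Ioc 0 1)
  have : IsProbabilityMeasure μ := ⟨by simp [μ]⟩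
  have hpt : ∀ x, ‖u (x + h) - u x‖ₑ ^ 2 ≤
      ∫⁻ t, ‖h‖ₑ ^ 2 * ‖fderiv ℝ u (x + t • h)‖ₑ ^ 2 ∂μ := by
    intro x
    have hd : ∀ t : ℝ, HasDerivAt (fun t : ℝ => u (x + t • h)) (fderiv ℝ u (x + t • h) h) t := by
      intro t
      have h1 : HasDerivAt (fun t : ℝ => x + t • h) h t := by
        simpa using ((hasDerivAt_id t).smul_const h).const_add x
      exact ((hu.differentiable (by simp) _).hasFDerivAt).comp_hasDerivAt t h1
    have hc1 : Continuous fun t : ℝ => fderiv ℝ u (x + t • h) h :=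
      (hc.comp (by fun_prop)).clm_apply continuous_const
    have hint := intervalIntegral.integral_eq_sub_of_hasDerivAt (fun t _ => hd t)
      (hc1.intervalIntegrable 0 1)
    simp only [one_smul, zero_smul, add_zero] at hint
    rw [← hint, intervalIntegral.integral_of_le zero_le_one]
    calc ‖∫ t, fderiv ℝ u (x + t • h) h ∂μ‖ₑ ^ 2
        ≤ (∫⁻ t, ‖fderiv ℝ u (x + t • h) h‖ₑ ∂μ) ^ 2 := by
          gcongr
          exact enorm_integral_le_lintegral_enorm _
      _ ≤ ∫⁻ t, ‖fderiv ℝ u (x + t • h) h‖ₑ ^ 2 ∂μ :=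
          sq_lintegral_le_lintegral_sq μ hc1.enorm.aemeasurable
      _ ≤ ∫⁻ t, ‖h‖ₑ ^ 2 * ‖fderiv ℝ u (x + t • h)‖ₑ ^ 2 ∂μ := by
          refine lintegral_mono fun t => ?_
          rw [← mul_pow, mul_comm ‖h‖ₑ]
          gcongr
          exact ContinuousLinearMap.le_opENorm _ _
  calc ∫⁻ x, ‖u (x + h) - u x‖ₑ ^ 2
      ≤ ∫⁻ x, ∫⁻ t, ‖h‖ₑ ^ 2 * ‖fderiv ℝ u (x + t • h)‖ₑ ^ 2 ∂μ := lintegral_mono hpt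
    _ = ∫⁻ t, (∫⁻ x, ‖h‖ₑ ^ 2 * ‖fderiv ℝ u (x + t • h)‖ₑ ^ 2) ∂μ := by
        rw [lintegral_lintegral_swap]
        refine Measurable.aemeasurable ?_
        refine Measurable.const_mul (Measurable.pow_const ?_ 2) _
        exact (hc.comp (by fun_prop : Continuous fun z : Space d × ℝ => z.1 + z.2 • h)).enorm.measurable
    _ = ∫⁻ _t, (‖h‖ₑ ^ 2 * ∫⁻ x, ‖fderiv ℝ u x‖ₑ ^ 2) ∂μ := by
        refine lintegral_congr fun t => ?_
        rw [lintegral_const_mul _ (by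
          exact ((hc.comp (by fun_prop : Continuous fun z : Space d => z + t • h)).enorm.measurable.pow_const 2))]
        rw [lintegral_add_right_eq_self (μ := volume) (fun x => ‖fderiv ℝ u x‖ₑ ^ 2) (t • h)]
    _ = _ := by simp

/-- The uniform probability measure on the ball of radius `ε` about the origin. -/
noncomputable def ballMeasure (d : ℕ) (ε : ℝ) : Measure (Space d) :=
  ProbabilityTheory.cond volume (Metric.ball 0 ε)

/-- The average of `u` over the ball of radius `ε` about `x`. -/
noncomputable def ballAvg (ε : ℝ) (u : Space d → Space N) (x : Space d) : Space N :=
  ∫ h, u (x + h) ∂ballMeasure d ε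

lemma isProbabilityMeasure_ballMeasure {ε : ℝ} (hε : 0 < ε) :
    IsProbabilityMeasure (ballMeasure d ε) :=
  ProbabilityTheory.cond_isProbabilityMeasure_of_finite
    (Metric.measure_ball_pos _ _ hε).ne' measure_ball_lt_top.ne

/-- The weight whose integral against `u` is the average of `u` over the ball about `x`. -/
noncomputable def ballWeight (ε : ℝ) (x : Space d) : Space d → ℝ :=
  (Metric.ball x ε).indicator fun _ => (volume (Metric.ball (0 : Space d) ε)).toReal⁻¹

lemma memLp_ballWeight (ε : ℝ) (x : Space d) (q : ENNReal) :
    MemLp (ballWeight ε x) q volume :=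
  memLp_indicator_const _ measurableSet_ball _ (Or.inr measure_ball_lt_top.ne)

/-- The weight lies in every `L^q`, so this form exhibits the average at a point as a continuous
linear functional on each `L^p`. -/
lemma ballAvg_eq_integral (ε : ℝ) (u : Space d → Space N) (x : Space d) :
    ballAvg ε u x = ∫ y, ballWeight ε x y • u y := by
  have h1 : ∀ y, ballWeight ε x y • u y = (volume (Metric.ball (0 : Space d) ε)).toReal⁻¹ •
      (Metric.ball x ε).indicator u y := by
    intro y
    by_cases hy : y ∈ Metric.ball x ε <;> simp only [ballWeight, Set.indicator, hy, if_true, if_false, zero_smul, smul_zero]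
  have h2 : ∀ y, (Metric.ball x ε).indicator u (x + y) =
      (Metric.ball 0 ε).indicator (fun h => u (x + h)) y := by
    intro y
    simp [Set.indicator, Metric.mem_ball, dist_eq_norm]
  rw [ballAvg, ballMeasure, ProbabilityTheory.cond, integral_smul_measure, ENNReal.toReal_inv]
  simp_rw [h1]
  rw [integral_smul, ← integral_add_left_eq_self (μ := volume) _ x]
  simp_rw [h2]
  rw [integral_indicator measurableSet_ball]

lemma ballAvg_congr_ae (ε : ℝ) {u v : Space d → Space N} (h : u =ᵐ[volume] v) (x : Space d) :
    ballAvg ε u x = ballAvg ε v x := by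
  simp only [ballAvg_eq_integral]
  refine integral_congr_ae ?_
  filter_upwards [h] with y hy
  rw [hy]

lemma ballAvg_translate (ε : ℝ) (u : Space d → Space N) (x y : Space d) :
    ballAvg ε (fun z => u (z + y)) x = ballAvg ε u (x + y) := by
  simp only [ballAvg]
  congr 1
  funext h
  congr 1
  abel

/-- Cauchy–Schwarz over the ball reduces this to the translation estimate with `‖h‖ < ε`. The bound
is global in space and drives both the nonvanishing argument and local compactness. -/
lemma lintegral_sq_enorm_sub_ballAvg_le {u : Space d → Space N} (hu : ContDiff ℝ 1 u)
    {ε : ℝ} (hε : 0 < ε) :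
    ∫⁻ x, ‖u x - ballAvg ε u x‖ₑ ^ 2 ≤
      ENNReal.ofReal ε ^ 2 * ∫⁻ x, ‖fderiv ℝ u x‖ₑ ^ 2 := by
  have := isProbabilityMeasure_ballMeasure (d := d) hε
  have hmem : ∀ᵐ h ∂ballMeasure d ε, h ∈ Metric.ball (0 : Space d) ε :=
    ProbabilityTheory.ae_cond_mem measurableSet_ball
  have hint : ∀ x, Integrable (fun h => u (x + h)) (ballMeasure d ε) := by
    intro x
    have h1 : IntegrableOn (fun h => u (x + h)) (Metric.ball 0 ε) volume :=
      ((hu.continuous.comp (continuous_const_add x)).continuousOn.integrableOn_compact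
        (isCompact_closedBall 0 ε)).mono_set Metric.ball_subset_closedBall
    exact h1.smul_measure (ENNReal.inv_ne_top.2 (Metric.measure_ball_pos _ _ hε).ne')
  calc ∫⁻ x, ‖u x - ballAvg ε u x‖ₑ ^ 2
      ≤ ∫⁻ x, ∫⁻ h, ‖u (x + h) - u x‖ₑ ^ 2 ∂ballMeasure d ε := by
        refine lintegral_mono fun x => ?_
        have h1 : u x - ballAvg ε u x = ∫ h, (u x - u (x + h)) ∂ballMeasure d ε := by
          rw [integral_sub (integrable_const _) (hint x)]
          simp [ballAvg]
        have hc : Continuous fun h => ‖u (x + h) - u x‖ₑ := by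
          have := hu.continuous
          fun_prop
        calc ‖u x - ballAvg ε u x‖ₑ ^ 2
            ≤ (∫⁻ h, ‖u x - u (x + h)‖ₑ ∂ballMeasure d ε) ^ 2 := by
              rw [h1]
              gcongr
              exact enorm_integral_le_lintegral_enorm _
          _ = (∫⁻ h, ‖u (x + h) - u x‖ₑ ∂ballMeasure d ε) ^ 2 := by
              simp_rw [enorm_sub_rev (u x)]
          _ ≤ _ := sq_lintegral_le_lintegral_sq _ hc.aemeasurable
    _ = ∫⁻ h, (∫⁻ x, ‖u (x + h) - u x‖ₑ ^ 2) ∂ballMeasure d ε := by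
        rw [lintegral_lintegral_swap]
        have hc : Continuous fun z : Space d × Space d => ‖u (z.1 + z.2) - u z.1‖ₑ := by
          have := hu.continuous
          fun_prop
        exact (hc.measurable.pow_const 2).aemeasurable
    _ ≤ ∫⁻ _h, (ENNReal.ofReal ε ^ 2 * ∫⁻ x, ‖fderiv ℝ u x‖ₑ ^ 2) ∂ballMeasure d ε := by
        refine lintegral_mono_ae ?_
        filter_upwards [hmem] with h hh
        refine (lintegral_sq_enorm_translate_sub_le hu h).trans ?_
        gcongr
        rw [← ofReal_norm]
        exact ENNReal.ofReal_le_ofReal (by simpa using (Metric.mem_ball.1 hh).le)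
    _ = _ := by simp

end Average

/-! ### The homogeneous Sobolev space as a Hilbert space of gradients -/

section Completion

variable {d N : ℕ}

instance [hd : Fact (3 ≤ d)] : Fact (1 ≤ sobExp d) := ⟨one_le_sobExp hd.out⟩

lemma norm_sq_gradSpace (g : GradSpace d N) : ‖g‖ ^ 2 = ∑ i, ∫ x, ‖g i x‖ ^ 2 := by
  rw [PiLp.norm_sq_eq_of_L2]
  refine Finset.sum_congr rfl fun i _ => ?_
  rw [← real_inner_self_eq_norm_sq, L2.inner_def]
  simp

lemma gradNorm_gradSpace (g : GradSpace d N) : gradNorm (fun i => g i) = ‖g‖ := by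
  rw [gradNorm, ← norm_sq_gradSpace, Real.sqrt_sq (norm_nonneg _)]

lemma gradNorm_congr_ae {f g : Fin d → Space d → Space N} (h : ∀ i, f i =ᵐ[volume] g i) :
    gradNorm f = gradNorm g := by
  rw [gradNorm, gradNorm]
  congr 1
  refine Finset.sum_congr rfl fun i _ => integral_congr_ae ?_
  filter_upwards [h i] with x hx
  rw [hx]

/-- The homogeneous Sobolev space, as the closure of the gradients of test maps. -/
noncomputable def hdot (d N : ℕ) : Submodule ℝ (GradSpace d N) :=
  (LinearMap.range (testGrad d N)).topologicalClosure

instance : CompleteSpace (hdot d N) :=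
  (Submodule.isClosed_topologicalClosure _).completeSpace_coe

/-- The class of a test map in the homogeneous Sobolev space. -/
noncomputable def testToHdot (d N : ℕ) : TestMap d N →ₗ[ℝ] hdot d N :=
  (testGrad d N).codRestrict (hdot d N) fun φ =>
    Submodule.le_topologicalClosure _ (LinearMap.mem_range_self _ φ)

lemma coe_testToHdot (φ : TestMap d N) : (testToHdot d N φ : GradSpace d N) = testGrad d N φ := rfl

lemma norm_testToHdot (φ : TestMap d N) : ‖testToHdot d N φ‖ = ‖testGrad d N φ‖ := rfl

lemma denseRange_testToHdot : DenseRange (testToHdot d N) := by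
  intro h
  rw [Topology.IsEmbedding.subtypeVal.closure_eq_preimage_closure_image]
  have h1 : (Subtype.val '' Set.range (testToHdot d N)) = Set.range (testGrad d N) := by
    rw [← Set.range_comp]
    rfl
  rw [Set.mem_preimage, h1]
  exact h.2

lemma exists_seq_tendsto_testToHdot (h : hdot d N) :
    ∃ φ : ℕ → TestMap d N, Tendsto (fun n => testToHdot d N (φ n)) atTop (𝓝 h) := by
  obtain ⟨x, hx, hlim⟩ := mem_closure_iff_seq_limit.1 (denseRange_testToHdot h)
  choose φ hφ using hx
  exact ⟨φ, by simpa [hφ] using hlim⟩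

/-- The Sobolev embedding of the homogeneous Sobolev space. -/
noncomputable def sobEmb (d N : ℕ) [Fact (3 ≤ d)] :
    hdot d N →L[ℝ] Lp (Space N) (sobExp d) (volume : Measure (Space d)) :=
  (testToLp d N (sobExp d)).extendOfNorm (testToHdot d N)

lemma sobEmb_testToHdot [hd : Fact (3 ≤ d)] (φ : TestMap d N) :
    sobEmb d N (testToHdot d N φ) = testToLp d N (sobExp d) φ := by
  obtain ⟨C, -, hC⟩ := exists_norm_testToLp_le (N := N) hd.out
  exact LinearMap.extendOfNorm_eq denseRange_testToHdot ⟨C, hC⟩ φ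

/-- Hölder's inequality with the conjugate exponent `(1 - p⁻¹)⁻¹`; asking for `w` in every `L^q`
avoids naming that exponent in applications. -/
lemma exists_clm_integral_smul (p : ENNReal) [hp : Fact (1 ≤ p)] {w : Space d → ℝ}
    (hw : ∀ q, MemLp w q volume) :
    ∃ L : Lp (Space N) p (volume : Measure (Space d)) →L[ℝ] Space N,
      ∀ u, L u = ∫ x, w x • u x := by
  have : ENNReal.HolderConjugate (1 - p⁻¹)⁻¹ p := (ENNReal.HolderConjugate.inv_one_sub_inv' hp.out).symm
  have : Fact (1 ≤ (1 - p⁻¹)⁻¹) := ⟨ENNReal.HolderConjugate.one_le _ p⟩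
  refine ⟨(ContinuousLinearMap.lsmul ℝ ℝ).lpPairing volume (1 - p⁻¹)⁻¹ p ((hw _).toLp w),
    fun u => ?_⟩
  rw [ContinuousLinearMap.lpPairing_eq_integral]
  refine integral_congr_ae ?_
  filter_upwards [(hw (1 - p⁻¹)⁻¹).coeFn_toLp] with x hx
  simp [hx]

lemma tendsto_eLpNorm_one_restrict {p : ENNReal} (hp : 1 ≤ p) {f : ℕ → Space d → Space N}
    (hf : ∀ n, AEStronglyMeasurable (f n) volume)
    (h : Tendsto (fun n => eLpNorm (f n) p volume) atTop (𝓝 0)) {K : Set (Space d)}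
    (hK : IsCompact K) :
    Tendsto (fun n => eLpNorm (f n) 1 (volume.restrict K)) atTop (𝓝 0) := by
  have hne : (volume.restrict K) Set.univ ^ (1 / (1 : ENNReal).toReal - 1 / p.toReal) ≠ ⊤ := by
    refine ENNReal.rpow_ne_top_of_nonneg ?_ (by simpa using hK.measure_lt_top.ne)
    rcases eq_or_ne p ⊤ with rfl | hp'
    · simp
    · have : 1 ≤ p.toReal := by
        rw [← ENNReal.toReal_one]
        exact ENNReal.toReal_mono hp' hp
      simp only [ENNReal.toReal_one, div_one, sub_nonneg]
      rw [div_le_one (by linarith)]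
      exact this
  have h2 := ENNReal.Tendsto.mul_const h (Or.inr hne)
  rw [zero_mul] at h2
  refine tendsto_of_tendsto_of_tendsto_of_le_of_le tendsto_const_nhds h2 (fun _ => zero_le)
    fun n => ?_
  refine (eLpNorm_le_eLpNorm_mul_rpow_measure_univ hp (hf n).restrict).trans ?_
  gcongr
  exact Measure.restrict_le_self

lemma Lp.tendsto_eLpNorm_sub {p : ENNReal} [Fact (1 ≤ p)]
    {u : ℕ → Lp (Space N) p (volume : Measure (Space d))}
    {v : Lp (Space N) p (volume : Measure (Space d))} (h : Tendsto u atTop (𝓝 v))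
    {f : ℕ → Space d → Space N} (hf : ∀ n, u n =ᵐ[volume] f n) {g : Space d → Space N}
    (hg : v =ᵐ[volume] g) :
    Tendsto (fun n => eLpNorm (fun x => f n x - g x) p volume) atTop (𝓝 0) := by
  have h1 := (Lp.tendsto_Lp_iff_tendsto_eLpNorm' u v).1 h
  refine h1.congr fun n => eLpNorm_congr_ae ?_
  filter_upwards [hf n, hg] with x h1 h2
  simp [h1, h2]

lemma integral_smul_pderiv_eq (i : Fin d) {η : Space d → ℝ} (hη : ContDiff ℝ ∞ η)
    (hη' : HasCompactSupport η) (φ : TestMap d N) :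
    ∫ x, η x • pderiv i φ.1 x = -∫ x, pderiv i η x • φ.1 x := by
  have hc : Continuous (pderiv i η) :=
    (hη.continuous_fderiv (by simp)).clm_apply continuous_const
  refine integral_smul_fderiv_eq_neg_fderiv_smul_of_integrable ?_ ?_ ?_
    (fun x _ => (hη.differentiable (by simp)) x) (fun x _ => φ.differentiable x)
  · exact (hc.smul φ.contDiff.continuous).integrable_of_hasCompactSupport
      (φ.hasCompactSupport.smul_left)
  · exact (hη.continuous.smul (φ.continuous_pderiv i)).integrable_of_hasCompactSupport
      (hη'.smul_right)
  · exact (hη.continuous.smul φ.contDiff.continuous).integrable_of_hasCompactSupport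
      (hη'.smul_right)

/-- Both sides of the integration by parts formula are continuous in `h`, so it passes from test
maps to their closure. -/
lemma memHomogeneousSobolev_sobEmb [hd : Fact (3 ≤ d)] (h : hdot d N) :
    MemHomogeneousSobolev (sobEmb d N h) (fun i => h.1 i) where
  hasWeakGradient :=
    { locallyIntegrable := (Lp.memLp _).locallyIntegrable (one_le_sobExp hd.out)
      locallyIntegrable_grad := fun i => (Lp.memLp _).locallyIntegrable (by norm_num)
      integral_eq := by
        intro i η hη hη'
        have hc : Continuous (pderiv i η) :=
          (hη.continuous_fderiv (by simp)).clm_apply continuous_const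
        obtain ⟨L₁, hL₁⟩ := exists_clm_integral_smul (N := N) 2 (w := η)
          fun q => hη.continuous.memLp_of_hasCompactSupport hη'
        obtain ⟨L₂, hL₂⟩ := exists_clm_integral_smul (N := N) (sobExp d) (w := pderiv i η)
          fun q => hc.memLp_of_hasCompactSupport (hη'.fderiv_apply ℝ _)
        rw [← hL₁, ← hL₂]
        have hcont : Continuous fun h : hdot d N => L₁ (h.1 i) := by fun_prop
        refine denseRange_testToHdot.induction_on h (isClosed_eq hcont (by fun_prop)) fun φ => ?_
        rw [hL₁, hL₂, sobEmb_testToHdot, coe_testToHdot]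
        refine Eq.trans (integral_congr_ae ?_)
          ((integral_smul_pderiv_eq i hη hη' φ).trans (congrArg _ (integral_congr_ae ?_)))
        · filter_upwards [coeFn_testGrad φ i] with x hx
          rw [hx]
        · filter_upwards [coeFn_testToLp (sobExp d) φ] with x hx
          rw [hx] }
  memLp_grad i := Lp.memLp _
  exists_approx := by
    obtain ⟨φ, hφ⟩ := exists_seq_tendsto_testToHdot h
    refine ⟨fun n => (φ n).1, fun n => (φ n).contDiff, fun n => (φ n).hasCompactSupport,
      fun i => ?_, fun K hK => ?_⟩
    · have hcont : Continuous fun h : hdot d N => h.1 i := by fun_prop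
      exact Lp.tendsto_eLpNorm_sub ((hcont.tendsto h).comp hφ)
        (fun n => coeFn_testGrad (φ n) i) EventuallyEq.rfl
    · refine tendsto_eLpNorm_one_restrict (one_le_sobExp hd.out)
        (fun n => ((φ n).memLp 1).1.sub (Lp.memLp _).1) ?_ hK
      refine Lp.tendsto_eLpNorm_sub (((sobEmb d N).continuous.tendsto h).comp hφ) (fun n => ?_)
        EventuallyEq.rfl
      simp only [Function.comp, sobEmb_testToHdot]
      exact coeFn_testToLp _ _

/-- The gradients of the approximating maps converge in `L²`, so by the Sobolev inequality the maps
converge in `L^p` to some `v`. They also converge to `u` in `L¹` on compact sets, whence `v = u`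
almost everywhere. -/
lemma MemHomogeneousSobolev.exists_hdot [hd : Fact (3 ≤ d)] {u : Space d → Space N}
    {g : Fin d → Space d → Space N} (hu : MemHomogeneousSobolev u g) :
    ∃ h : hdot d N, ‖h‖ = gradNorm g ∧ sobEmb d N h =ᵐ[volume] u := by
  obtain ⟨φ, hs, hc, hg, hK⟩ := hu.exists_approx
  set ψ : ℕ → TestMap d N := fun n => ⟨φ n, hs n, hc n⟩
  set g' : GradSpace d N := WithLp.toLp 2 fun i => (hu.memLp_grad i).toLp with hg'
  have hg'i : ∀ i, g' i =ᵐ[volume] g i := fun i => (hu.memLp_grad i).coeFn_toLp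
  have hlim : Tendsto (fun n => testGrad d N (ψ n)) atTop (𝓝 g') := by
    rw [(PiLp.homeomorph 2 _).isInducing.tendsto_nhds_iff, tendsto_pi_nhds]
    intro i
    rw [Lp.tendsto_Lp_iff_tendsto_eLpNorm']
    refine (hg i).congr fun n => eLpNorm_congr_ae ?_
    filter_upwards [hg'i i, coeFn_testGrad (ψ n) i] with x h1 h2
    exact (congrArg₂ (· - ·) h2 h1).symm
  have hmem : g' ∈ hdot d N :=
    mem_closure_of_tendsto hlim (Eventually.of_forall fun n => LinearMap.mem_range_self _ (ψ n))
  have hlim' : Tendsto (fun n => testToHdot d N (ψ n)) atTop (𝓝 ⟨g', hmem⟩) :=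
    tendsto_subtype_rng.2 hlim
  refine ⟨⟨g', hmem⟩, ?_, ?_⟩
  · rw [← gradNorm_congr_ae hg'i, gradNorm_gradSpace]
    rfl
  set v := sobEmb d N ⟨g', hmem⟩
  have hv : Tendsto (fun n => eLpNorm (fun x => φ n x - v x) (sobExp d) volume) atTop (𝓝 0) := by
    refine Lp.tendsto_eLpNorm_sub (((sobEmb d N).continuous.tendsto _).comp hlim') (fun n => ?_)
      EventuallyEq.rfl
    simp only [Function.comp, sobEmb_testToHdot]
    exact coeFn_testToLp _ (ψ n)
  have hball : ∀ n : ℕ, v =ᵐ[volume.restrict (Metric.closedBall 0 n)] u := by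
    intro n
    have hcomp := isCompact_closedBall (0 : Space d) (n : ℝ)
    have h1 := tendsto_eLpNorm_one_restrict (one_le_sobExp hd.out)
      (fun n => ((hs n).continuous.aestronglyMeasurable).sub (Lp.memLp v).1) hv hcomp
    have h2 := hK _ hcomp
    have h3 : eLpNorm (fun x => v x - u x) 1 (volume.restrict (Metric.closedBall 0 n)) = 0 := by
      refine le_antisymm (ge_of_tendsto' (by simpa using h1.add h2) fun k => ?_) (zero_le)
      have hum := hu.hasWeakGradient.locallyIntegrable.aestronglyMeasurable
      have hkm := (hs k).continuous.aestronglyMeasurable (μ := volume)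
      have h4 := eLpNorm_add_le (p := 1) (μ := volume.restrict (Metric.closedBall 0 n))
        (f := fun x => v x - φ k x) (g := fun x => φ k x - u x)
        (((Lp.memLp v).1.sub hkm).restrict) ((hkm.sub hum).restrict) le_rfl
      have h5 : (fun x => v x - φ k x) + (fun x => φ k x - u x) = fun x => v x - u x := by
        funext x; simp
      rw [h5] at h4
      refine h4.trans (add_le_add (le_of_eq ?_) le_rfl)
      exact eLpNorm_sub_comm _ _ _ _
    have h4 := (eLpNorm_eq_zero_iff (((Lp.memLp v).1.sub
      hu.hasWeakGradient.locallyIntegrable.aestronglyMeasurable).restrict) one_ne_zero).1 h3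
    filter_upwards [h4] with x hx
    exact sub_eq_zero.1 hx
  have := (ae_restrict_iUnion_iff (μ := volume) (fun n : ℕ => Metric.closedBall (0 : Space d) n)
    (fun x => v x = u x)).2 hball
  rwa [Metric.iUnion_closedBall_nat, Measure.restrict_univ] at this

end Completion

/-! ### The energy: growth, continuity and the Brezis–Lieb splitting -/

/-- A continuous positive integrand of subcritical growth at zero and at infinity. -/
structure SubcriticalIntegrand (d : ℕ) {N : ℕ} (G : Space N → ℝ) : Prop where
  continuous : Continuous G
  pos : ∀ a, a ≠ 0 → 0 < G a
  map_zero : G 0 = 0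
  tendsto_zero : Tendsto (fun a => ‖a‖ ^ (-critExp d) * G a) (𝓝[≠] 0) (𝓝 0)
  tendsto_cobounded :
    Tendsto (fun a => ‖a‖ ^ (-critExp d) * G a) (Bornology.cobounded (Space N)) (𝓝 0)
  increment : ∀ δ : ℝ, 0 < δ → ∃ C : ℝ, 0 < C ∧ ∀ a b : Space N,
      |G (a + b) - G a| ≤ δ * ‖a‖ ^ critExp d + C * ‖b‖ ^ critExp d

section Integrand

variable {d N : ℕ} {G : Space N → ℝ}

namespace SubcriticalIntegrand

lemma nonneg (hG : SubcriticalIntegrand d G) (a : Space N) : 0 ≤ G a := by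
  rcases eq_or_ne a 0 with rfl | ha
  · exact hG.map_zero.ge
  · exact (hG.pos a ha).le

/-- This is the increment condition at base point `0`. -/
lemma exists_le_rpow (hG : SubcriticalIntegrand d G) (hd : 3 ≤ d) :
    ∃ C : ℝ, 0 < C ∧ ∀ a, G a ≤ C * ‖a‖ ^ critExp d := by
  obtain ⟨C, hC, h⟩ := hG.increment 1 one_pos
  refine ⟨C, hC, fun a => ?_⟩
  have := h 0 a
  rw [zero_add, norm_zero, Real.zero_rpow (critExp_pos hd).ne', mul_zero, zero_add, hG.map_zero,
    sub_zero] at this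
  exact (le_abs_self _).trans this

lemma le_of_rpow_neg_mul_le {p ε r : ℝ} (a : Space N) (ha : a ≠ 0)
    (h : ‖a‖ ^ (-p) * r ≤ ε) : r ≤ ε * ‖a‖ ^ p := by
  have h0 : 0 < ‖a‖ ^ p := Real.rpow_pos_of_pos (norm_pos_iff.2 ha) _
  rw [Real.rpow_neg (norm_nonneg _), inv_mul_le_iff₀ h0] at h
  linarith

/-- The two limits control `G` near `0` and near infinity; on the remaining bounded set `G` is
bounded by continuity. This is how subcriticality excludes concentration and spreading by dilation.
-/
lemma exists_le_rpow_add (hG : SubcriticalIntegrand d G) {ε : ℝ} (hε : 0 < ε) :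
    ∃ c K : ℝ, 0 < c ∧ 0 < K ∧
      ∀ a, G a ≤ ε * ‖a‖ ^ critExp d + {b : Space N | c < ‖b‖}.indicator (fun _ => K) a := by
  obtain ⟨c, hc, h0⟩ : ∃ c > 0, ∀ a : Space N, a ≠ 0 → ‖a‖ < c →
      ‖a‖ ^ (-critExp d) * G a ≤ ε := by
    have := (hG.tendsto_zero.eventually (ge_mem_nhds hε))
    rw [eventually_nhdsWithin_iff, Metric.eventually_nhds_iff] at this
    obtain ⟨c, hc, h⟩ := this
    exact ⟨c, hc, fun a ha hac => h (by simpa using hac) ha⟩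
  obtain ⟨R, h1⟩ : ∃ R : ℝ, ∀ a : Space N, R ≤ ‖a‖ → ‖a‖ ^ (-critExp d) * G a ≤ ε := by
    have := (hG.tendsto_cobounded.eventually (ge_mem_nhds hε))
    rw [← comap_norm_atTop, eventually_comap] at this
    obtain ⟨R, h⟩ := eventually_atTop.1 this
    exact ⟨R, fun a ha => h _ ha a rfl⟩
  obtain ⟨K, hK⟩ := (isCompact_closedBall (0 : Space N) R).bddAbove_image hG.continuous.continuousOn
  have hpos : ∀ a : Space N, 0 ≤ ε * ‖a‖ ^ critExp d := fun a => by positivity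
  refine ⟨c / 2, max K 1, by positivity, by positivity, fun a => ?_⟩
  by_cases hac : c / 2 < ‖a‖
  · rw [Set.indicator_of_mem (by exact hac)]
    by_cases haR : R ≤ ‖a‖
    · have ha : a ≠ 0 := norm_pos_iff.1 (by linarith)
      have := le_of_rpow_neg_mul_le a ha (h1 a haR)
      have : (0 : ℝ) < max K 1 := by positivity
      linarith
    · have := hK ⟨a, by simpa using (not_le.1 haR).le, rfl⟩
      have := le_max_left K 1
      linarith [hpos a]
  · rw [Set.indicator_of_notMem (by exact hac), add_zero]
    rcases eq_or_ne a 0 with rfl | ha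
    · rw [hG.map_zero]
      exact hpos 0
    · exact le_of_rpow_neg_mul_le a ha (h0 a ha (by linarith))

end SubcriticalIntegrand

/-- The integral of `G` along a class in the critical Lebesgue space. -/
noncomputable def energy (G : Space N → ℝ)
    (u : Lp (Space N) (sobExp d) (volume : Measure (Space d))) : ℝ :=
  ∫ x, G (u x)

variable [hd : Fact (3 ≤ d)]

lemma integrable_norm_rpow_critExp (u : Lp (Space N) (sobExp d) (volume : Measure (Space d))) :
    Integrable (fun x => ‖u x‖ ^ critExp d) volume := by
  have := (Lp.memLp u).integrable_norm_rpow (sobExp_ne_zero hd.out) sobExp_ne_top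
  rwa [sobExp_toReal hd.out] at this

lemma integral_norm_rpow_critExp (u : Lp (Space N) (sobExp d) (volume : Measure (Space d))) :
    ∫ x, ‖u x‖ ^ critExp d = ‖u‖ ^ critExp d := by
  have h := (Lp.memLp u).eLpNorm_eq_integral_rpow_norm (sobExp_ne_zero hd.out) sobExp_ne_top
  rw [sobExp_toReal hd.out] at h
  have h0 : 0 ≤ ∫ x, ‖u x‖ ^ critExp d := integral_nonneg fun x => by positivity
  rw [Lp.norm_def, h, ENNReal.toReal_ofReal (by positivity), ← Real.rpow_mul h0,
    inv_mul_cancel₀ (critExp_pos hd.out).ne', Real.rpow_one]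

namespace SubcriticalIntegrand

lemma integrable_comp (hG : SubcriticalIntegrand d G)
    (u : Lp (Space N) (sobExp d) (volume : Measure (Space d))) :
    Integrable (fun x => G (u x)) volume := by
  obtain ⟨C, -, hC⟩ := hG.exists_le_rpow hd.out
  refine ((integrable_norm_rpow_critExp u).const_mul C).mono'
    (hG.continuous.comp_aestronglyMeasurable (Lp.memLp u).1) (Eventually.of_forall fun x => ?_)
  rw [Real.norm_of_nonneg (hG.nonneg _)]
  exact hC _

lemma exists_energy_le (hG : SubcriticalIntegrand d G) :
    ∃ C : ℝ, 0 < C ∧ ∀ u : Lp (Space N) (sobExp d) (volume : Measure (Space d)),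
      energy G u ≤ C * ‖u‖ ^ critExp d := by
  obtain ⟨C, hC0, hC⟩ := hG.exists_le_rpow hd.out
  refine ⟨C, hC0, fun u => ?_⟩
  rw [← integral_norm_rpow_critExp, ← integral_const_mul]
  exact integral_mono (hG.integrable_comp u) ((integrable_norm_rpow_critExp u).const_mul C)
    fun x => hC _

lemma continuous_energy (hG : SubcriticalIntegrand d G) :
    Continuous (energy G : Lp (Space N) (sobExp d) (volume : Measure (Space d)) → ℝ) := by
  have hp := critExp_pos hd.out
  rw [continuous_iff_continuousAt]
  intro v
  rw [ContinuousAt, Metric.tendsto_nhds]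
  intro ε hε
  -- The added `1` keeps the denominator positive when `v = 0`.
  set δ : ℝ := ε / 2 / (‖v‖ ^ critExp d + 1)
  have hv : 0 < ‖v‖ ^ critExp d + 1 := by positivity
  obtain ⟨C, hC0, hC⟩ := hG.increment δ (by positivity)
  have hbound : ∀ u, |energy G u - energy G v| ≤ δ * ‖v‖ ^ critExp d + C * ‖u - v‖ ^ critExp d := by
    intro u
    have i1 := (integrable_norm_rpow_critExp v).const_mul δ
    have i2 := (integrable_norm_rpow_critExp (u - v)).const_mul C
    rw [energy, energy, ← integral_sub (hG.integrable_comp u) (hG.integrable_comp v),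
      ← integral_norm_rpow_critExp, ← integral_norm_rpow_critExp, ← integral_const_mul,
      ← integral_const_mul, ← integral_add i1 i2]
    refine (abs_integral_le_integral_abs).trans (integral_mono_ae
      ((hG.integrable_comp u).sub (hG.integrable_comp v)).abs (i1.add i2) ?_)
    filter_upwards [Lp.coeFn_sub u v] with x hx
    have := hC (v x) (u x - v x)
    rw [add_sub_cancel] at this
    simp only [Pi.sub_apply] at hx ⊢
    rw [hx]
    exact this
  have hlim : Tendsto (fun u => δ * ‖v‖ ^ critExp d + C * ‖u - v‖ ^ critExp d) (𝓝 v)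
      (𝓝 (δ * ‖v‖ ^ critExp d + C * ‖v - v‖ ^ critExp d)) := by
    have : Continuous fun u => δ * ‖v‖ ^ critExp d + C * ‖u - v‖ ^ critExp d := by
      have := hp.le
      fun_prop (disch := simp [this])
    exact this.tendsto v
  rw [sub_self, norm_zero, Real.zero_rpow hp.ne', mul_zero, add_zero] at hlim
  have hlt : δ * ‖v‖ ^ critExp d < ε := by
    have : δ * (‖v‖ ^ critExp d + 1) = ε / 2 := div_mul_cancel₀ _ hv.ne'
    have : 0 < δ := by positivity
    nlinarith
  filter_upwards [hlim.eventually (gt_mem_nhds hlt)] with u hu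
  exact (hbound u).trans_lt hu

/-- The Brezis–Lieb splitting of the energy along an almost everywhere convergent sequence. -/
lemma tendsto_energy_sub_energy_sub (hG : SubcriticalIntegrand d G)
    {u : ℕ → Lp (Space N) (sobExp d) (volume : Measure (Space d))}
    {v : Lp (Space N) (sobExp d) (volume : Measure (Space d))} {M : ℝ} (hM : ∀ n, ‖u n‖ ≤ M)
    (hlim : ∀ᵐ x, Tendsto (fun n => u n x) atTop (𝓝 (v x))) :
    Tendsto (fun n => energy G (u n) - energy G (u n - v)) atTop (𝓝 (energy G v)) := by
  have hp := critExp_pos hd.out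
  have hM0 : 0 ≤ M := (norm_nonneg _).trans (hM 0)
  obtain ⟨C₀, -, hC₀⟩ := hG.exists_le_rpow hd.out
  set f : ℕ → Space d → ℝ := fun n x => |G (u n x) - G ((u n - v) x) - G (v x)| with hf
  have hfi : ∀ n, Integrable (f n) volume := fun n =>
    (((hG.integrable_comp (u n)).sub (hG.integrable_comp (u n - v))).sub
      (hG.integrable_comp v)).abs
  have hle : ∀ n, |energy G (u n) - energy G (u n - v) - energy G v| ≤ ∫ x, f n x := by
    intro n
    rw [energy, energy, energy, ← integral_sub (hG.integrable_comp _) (hG.integrable_comp _),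
      ← integral_sub (by exact (hG.integrable_comp _).sub (hG.integrable_comp _))
        (hG.integrable_comp _)]
    exact abs_integral_le_integral_abs
  have hsub : ∀ᵐ x, ∀ n, (u n - v) x = u n x - v x := ae_all_iff.2 fun n => Lp.coeFn_sub _ _
  have hf0 : ∀ᵐ x, Tendsto (fun n => f n x) atTop (𝓝 0) := by
    filter_upwards [hlim, hsub] with x hx hs
    have h1 := (hG.continuous.tendsto _).comp hx
    have h2 := (hG.continuous.tendsto _).comp (hx.sub_const (v x))
    have h3 := ((h1.sub h2).sub_const (G (v x))).abs
    simp only [sub_self, hG.map_zero, sub_zero, abs_zero] at h3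
    refine h3.congr fun n => ?_
    simp only [hf, hs n, Function.comp_apply]
  rw [Metric.tendsto_atTop']
  intro ε hε
  -- A bound for `‖u n - v‖ ^ critExp d` uniform in `n`.
  set B : ℝ := (M + ‖v‖) ^ critExp d + 1
  have hB : 0 < B := by positivity
  obtain ⟨C, hC0, hC⟩ := hG.increment (ε / 2 / B) (by positivity)
  -- Removing a small multiple of `|u n - v|^p` from the error leaves a part dominated by `(C + C₀)
  -- |v|^p`, to which dominated convergence applies; the removed part has integral at most `ε / 2`.
  set w : ℕ → Space d → ℝ := fun n x => max (f n x - ε / 2 / B * ‖(u n - v) x‖ ^ critExp d) 0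
    with hw
  have hdi : ∀ n, Integrable (fun x => ε / 2 / B * ‖(u n - v) x‖ ^ critExp d) volume := fun n =>
    (integrable_norm_rpow_critExp (u n - v)).const_mul _
  have hwi : ∀ n, Integrable (w n) volume := fun n => ((hfi n).sub (hdi n)).pos_part
  have hw0 : Tendsto (fun n => ∫ x, w n x) atTop (𝓝 0) := by
    have := tendsto_integral_of_dominated_convergence (μ := volume) (F := w) (f := fun _ => 0)
      (fun x => (C + C₀) * ‖v x‖ ^ critExp d) (fun n => (hwi n).1)
      ((integrable_norm_rpow_critExp v).const_mul _) ?_ ?_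
    · simpa using this
    · intro n
      filter_upwards [hsub] with x hs
      rw [Real.norm_of_nonneg (le_max_right _ _)]
      have h1 := hC (u n x - v x) (v x)
      rw [sub_add_cancel, ← hs n] at h1
      have h2 := hC₀ (v x)
      have h3 : f n x ≤ |G (u n x) - G ((u n - v) x)| + |G (v x)| := abs_sub _ _
      rw [abs_of_nonneg (hG.nonneg (v x))] at h3
      have h4 : 0 ≤ C * ‖v x‖ ^ critExp d := by positivity
      refine max_le ?_ ?_ <;> linarith [hG.nonneg (v x)]
    · filter_upwards [hf0] with x hx
      refine squeeze_zero (fun n => le_max_right _ _) (fun n => ?_) hx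
      refine max_le ?_ (abs_nonneg _)
      have : 0 ≤ ε / 2 / B * ‖(u n - v) x‖ ^ critExp d := by positivity
      linarith
  have hfw : ∀ n, ∫ x, f n x ≤ (∫ x, w n x) + ε / 2 := by
    intro n
    have h1 : ∫ x, f n x ≤ ∫ x, (w n x + ε / 2 / B * ‖(u n - v) x‖ ^ critExp d) := by
      refine integral_mono (hfi n) ((hwi n).add (hdi n)) fun x => ?_
      have := le_max_left (f n x - ε / 2 / B * ‖(u n - v) x‖ ^ critExp d) 0
      simp only [hw]
      linarith
    rw [integral_add (hwi n) (hdi n), integral_const_mul, integral_norm_rpow_critExp] at h1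
    have h2 : ‖u n - v‖ ^ critExp d ≤ B := by
      refine (Real.rpow_le_rpow (norm_nonneg _) ((norm_sub_le _ _).trans
        (add_le_add_left (hM n) _)) hp.le).trans ?_
      simp [B]
    have h3 : ε / 2 / B * ‖u n - v‖ ^ critExp d ≤ ε / 2 / B * B := by gcongr
    rw [div_mul_cancel₀ _ hB.ne'] at h3
    linarith
  obtain ⟨n₀, hn₀⟩ := eventually_atTop.1 (hw0.eventually (gt_mem_nhds (half_pos hε)))
  refine ⟨n₀, fun n hn => ?_⟩
  rw [Real.dist_eq]
  linarith [hle n, hfw n, hn₀ n hn.le]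

end SubcriticalIntegrand

end Integrand

/-! ### Translations and dilations -/

section Symmetry

variable {d N : ℕ}

lemma norm_sq_testGrad (φ : TestMap d N) :
    ‖testGrad d N φ‖ ^ 2 = ∑ i, ∫ x, ‖pderiv i φ.1 x‖ ^ 2 := by
  rw [norm_sq_gradSpace]
  refine Finset.sum_congr rfl fun i _ => integral_congr_ae ?_
  filter_upwards [coeFn_testGrad φ i] with x hx
  rw [hx]

/-- The translate of a test map. -/
def TestMap.translate (y : Space d) (φ : TestMap d N) : TestMap d N :=
  ⟨fun x => φ.1 (x + y), φ.contDiff.comp (contDiff_id.add contDiff_const),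
    φ.hasCompactSupport.comp_homeomorph (Homeomorph.addRight y)⟩

lemma norm_testGrad_translate (y : Space d) (φ : TestMap d N) :
    ‖testGrad d N (φ.translate y)‖ = ‖testGrad d N φ‖ := by
  have h : ∀ i x, pderiv i (φ.translate y).1 x = pderiv i φ.1 (x + y) := by
    intro i x
    simp only [pderiv, TestMap.translate]
    rw [fderiv_comp_add_right]
  rw [← sq_eq_sq₀ (norm_nonneg _) (norm_nonneg _), norm_sq_testGrad, norm_sq_testGrad]
  refine Finset.sum_congr rfl fun i _ => ?_
  simp_rw [h]
  exact integral_add_right_eq_self (μ := volume) (fun x => ‖pderiv i φ.1 x‖ ^ 2) y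

/-- The dilate of a test map. -/
def TestMap.dilate (r : ℝ) (hr : r ≠ 0) (φ : TestMap d N) : TestMap d N :=
  ⟨fun x => φ.1 (r • x), φ.contDiff.comp (contDiff_const_smul r),
    φ.hasCompactSupport.comp_homeomorph (Homeomorph.smulOfNeZero r hr)⟩

lemma norm_sq_testGrad_dilate {r : ℝ} (hr : 0 < r) (φ : TestMap d N) :
    ‖testGrad d N (φ.dilate r hr.ne')‖ ^ 2 = r ^ 2 * (r ^ d)⁻¹ * ‖testGrad d N φ‖ ^ 2 := by
  have h : ∀ i x, pderiv i (φ.dilate r hr.ne').1 x = r • pderiv i φ.1 (r • x) := by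
    intro i x
    have h1 : HasFDerivAt (fun x : Space d => r • x) (r • ContinuousLinearMap.id ℝ _) x :=
      (hasFDerivAt_id x).const_smul r
    have h2 := ((φ.differentiable (r • x)).hasFDerivAt.comp x h1).fderiv
    simp only [pderiv, TestMap.dilate]
    rw [show (fun x => φ.1 (r • x)) = φ.1 ∘ fun x => r • x from rfl, h2]
    simp
  rw [norm_sq_testGrad, norm_sq_testGrad, Finset.mul_sum]
  refine Finset.sum_congr rfl fun i _ => ?_
  simp_rw [h, norm_smul, mul_pow, Real.norm_of_nonneg hr.le]
  rw [integral_const_mul, Measure.integral_comp_smul volume (fun x => ‖pderiv i φ.1 x‖ ^ 2) r,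
    finrank_euclideanSpace_fin, abs_of_pos (by positivity), smul_eq_mul, mul_assoc]

lemma integral_comp_dilate (G : Space N → ℝ) {r : ℝ} (hr : 0 < r) (φ : TestMap d N) :
    ∫ x, G ((φ.dilate r hr.ne').1 x) = (r ^ d)⁻¹ * ∫ x, G (φ.1 x) := by
  have := Measure.integral_comp_smul volume (fun x : Space d => G (φ.1 x)) r
  rw [finrank_euclideanSpace_fin, abs_of_pos (by positivity), smul_eq_mul] at this
  exact this

lemma exists_dilate_norm_eq_one (hd : 3 ≤ d) (G : Space N → ℝ) (φ : TestMap d N)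
    (hφ : testGrad d N φ ≠ 0) :
    ∃ ψ : TestMap d N, ‖testGrad d N ψ‖ = 1 ∧
      ∫ x, G (φ.1 x) = (∫ x, G (ψ.1 x)) * ‖testGrad d N φ‖ ^ critExp d := by
  set m := ‖testGrad d N φ‖
  have hm : 0 < m := norm_pos_iff.2 hφ
  have hd3 : (3 : ℝ) ≤ d := by exact_mod_cast hd
  have hd2 : (d : ℝ) - 2 ≠ 0 := by linarith
  -- This solves `r^(d-2) = m²`, which normalizes the gradient of the dilate.
  set r := m ^ (2 / ((d : ℝ) - 2))
  have hr : 0 < r := Real.rpow_pos_of_pos hm _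
  have hrd : r ^ d = m ^ critExp d := by
    rw [← Real.rpow_natCast, ← Real.rpow_mul hm.le, critExp]
    congr 1
    field_simp
  have hrd2 : r ^ d = m ^ 2 * r ^ 2 := by
    rw [← Real.rpow_natCast, ← Real.rpow_natCast, ← Real.rpow_natCast, ← Real.rpow_mul hm.le,
      ← Real.rpow_mul hm.le, ← Real.rpow_add hm]
    congr 1
    push_cast
    field_simp
    ring
  refine ⟨φ.dilate r hr.ne', ?_, ?_⟩
  · rw [← sq_eq_sq₀ (norm_nonneg _) zero_le_one, norm_sq_testGrad_dilate hr, hrd2]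
    change _ * m ^ 2 = _
    field_simp
  · rw [integral_comp_dilate G hr, hrd]
    have : m ^ critExp d ≠ 0 := (Real.rpow_pos_of_pos hm _).ne'
    field_simp

end Symmetry

/-! ### The supremum over test maps and the scaled inequality -/

section Supremum

variable {d N : ℕ} {G : Space N → ℝ}

lemma energy_testToLp (G : Space N → ℝ) (φ : TestMap d N) :
    energy G (testToLp d N (sobExp d) φ) = ∫ x, G (φ.1 x) := by
  refine integral_congr_ae ?_
  filter_upwards [coeFn_testToLp (sobExp d) φ] with x hx
  rw [hx]

/-- The supremum of the energies of test maps with normalized gradient. -/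
noncomputable def testSup (d : ℕ) {N : ℕ} (G : Space N → ℝ) : ℝ :=
  sSup ((fun φ : TestMap d N => ∫ x, G (φ.1 x)) '' {φ | ‖testGrad d N φ‖ = 1})

namespace SubcriticalIntegrand

lemma exists_testMap_pos (hG : SubcriticalIntegrand d G) (hN : 1 ≤ N) :
    ∃ φ : TestMap d N, 0 < ∫ x, G (φ.1 x) := by
  let η : ContDiffBump (0 : Space d) := ⟨1, 2, one_pos, one_lt_two⟩
  let e : Space N := EuclideanSpace.single ⟨0, hN⟩ 1
  have he : e ≠ 0 := by simp [e]
  let φ : TestMap d N := ⟨fun x => η x • e, η.contDiff.smul contDiff_const,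
    η.hasCompactSupport.smul_right⟩
  refine ⟨φ, (hG.continuous.comp φ.contDiff.continuous).integral_pos_of_hasCompactSupport_nonneg_nonzero
    (φ.hasCompactSupport.comp_left hG.map_zero) (fun x => hG.nonneg _) (x := 0) ?_⟩
  refine (hG.pos _ ?_).ne'
  have : η 0 = 1 := η.one_of_mem_closedBall (by simp [η])
  simp [φ, this, he]

variable [hd : Fact (3 ≤ d)]

lemma bddAbove_testSup (hG : SubcriticalIntegrand d G) :
    BddAbove ((fun φ : TestMap d N => ∫ x, G (φ.1 x)) '' {φ | ‖testGrad d N φ‖ = 1}) := by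
  obtain ⟨A, hA, hS⟩ := exists_norm_testToLp_le (N := N) hd.out
  obtain ⟨C, hC, hE⟩ := hG.exists_energy_le
  refine ⟨C * A ^ critExp d, ?_⟩
  rintro _ ⟨φ, hφ, rfl⟩
  have h1 := hS φ
  rw [Set.mem_ofPred_eq] at hφ
  rw [hφ, mul_one] at h1
  simp only
  rw [← energy_testToLp]
  refine (hE _).trans ?_
  gcongr
  exact (critExp_pos hd.out).le

/-- Dilation reduces to unit gradient norm. A vanishing gradient cannot be normalized; there the
Sobolev inequality makes the energy zero. -/
lemma integral_comp_le_testSup (hG : SubcriticalIntegrand d G) (φ : TestMap d N) :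
    ∫ x, G (φ.1 x) ≤ testSup d G * ‖testGrad d N φ‖ ^ critExp d := by
  by_cases hφ : testGrad d N φ = 0
  · obtain ⟨A, -, hS⟩ := exists_norm_testToLp_le (N := N) hd.out
    obtain ⟨C, -, hE⟩ := hG.exists_energy_le
    have h1 := hS φ
    rw [hφ, norm_zero, mul_zero] at h1
    have h2 := hE (testToLp d N (sobExp d) φ)
    rw [le_antisymm h1 (norm_nonneg _), Real.zero_rpow (critExp_pos hd.out).ne', mul_zero,
      energy_testToLp] at h2
    rwa [hφ, norm_zero, Real.zero_rpow (critExp_pos hd.out).ne', mul_zero]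
  · obtain ⟨ψ, hψ, h⟩ := exists_dilate_norm_eq_one hd.out G φ hφ
    rw [h]
    gcongr
    exact le_csSup hG.bddAbove_testSup ⟨ψ, hψ, rfl⟩

lemma energy_sobEmb_le (hG : SubcriticalIntegrand d G) (h : hdot d N) :
    energy G (sobEmb d N h) ≤ testSup d G * ‖h‖ ^ critExp d := by
  have hp := (critExp_pos hd.out).le
  refine denseRange_testToHdot.induction_on h (isClosed_le
    (hG.continuous_energy.comp (sobEmb d N).continuous)
    (by fun_prop (disch := simp [hp]))) fun φ => ?_
  rw [sobEmb_testToHdot, energy_testToLp, norm_testToHdot]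
  exact hG.integral_comp_le_testSup φ

lemma testSup_pos (hG : SubcriticalIntegrand d G) (hN : 1 ≤ N) : 0 < testSup d G := by
  obtain ⟨φ, hφ⟩ := hG.exists_testMap_pos (d := d) hN
  have h := hφ.trans_le (hG.integral_comp_le_testSup φ)
  by_contra hneg
  exact absurd h (not_lt.2 (mul_nonpos_of_nonpos_of_nonneg (not_lt.1 hneg) (by positivity)))

lemma exists_maximizing_seq (hG : SubcriticalIntegrand d G) (hN : 1 ≤ N) :
    ∃ φ : ℕ → TestMap d N, (∀ n, ‖testGrad d N (φ n)‖ = 1) ∧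
      Tendsto (fun n => ∫ x, G ((φ n).1 x)) atTop (𝓝 (testSup d G)) := by
  have hne : ((fun φ : TestMap d N => ∫ x, G (φ.1 x)) '' {φ | ‖testGrad d N φ‖ = 1}).Nonempty := by
    -- The supremum of the empty set takes the default value `0`, contradicting its positivity.
    by_contra hempty
    have := hG.testSup_pos (d := d) hN
    rw [testSup, Set.not_nonempty_iff_eq_empty.1 hempty, Real.sSup_empty] at this
    exact lt_irrefl _ this
  obtain ⟨s, -, hs, hmem⟩ := exists_seq_tendsto_sSup hne hG.bddAbove_testSup
  choose φ hφ using hmem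
  refine ⟨φ, fun n => (hφ n).1, ?_⟩
  have h2 : ∀ n, ∫ x, G ((φ n).1 x) = s n := fun n => (hφ n).2
  simp_rw [h2]
  exact hs

end SubcriticalIntegrand

end Supremum

/-! ### Weak sequential compactness in Hilbert space -/

section WeakCompactness

variable {H : Type*} [NormedAddCommGroup H] [InnerProductSpace ℝ H]

/-- Sequential Banach–Alaoglu in the dual, transported by the Riesz isomorphism. -/
lemma exists_subseq_tendsto_weakly [CompleteSpace H] [TopologicalSpace.SeparableSpace H] {x : ℕ → H} {M : ℝ}
    (hM : ∀ n, ‖x n‖ ≤ M) :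
    ∃ (h : H) (ns : ℕ → ℕ), StrictMono ns ∧
      ∀ L : H →L[ℝ] ℝ, Tendsto (fun k => L (x (ns k))) atTop (𝓝 (L h)) := by
  have hcomp := WeakDual.isSeqCompact_closedBall ℝ H (0 : StrongDual ℝ H) M
  obtain ⟨f, -, ns, hns, hlim⟩ := hcomp
    (x := fun n => StrongDual.toWeakDual (InnerProductSpace.toDual ℝ H (x n)))
    (fun n => by simpa using hM n)
  refine ⟨(InnerProductSpace.toDual ℝ H).symm (WeakDual.toStrongDual f), ns, hns, fun L => ?_⟩
  have h1 := ((WeakDual.eval_continuous ((InnerProductSpace.toDual ℝ H).symm L)).tendsto f).comp hlim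
  have h2 : ∀ y : H, L y = inner ℝ y ((InnerProductSpace.toDual ℝ H).symm L) := by
    intro y
    rw [real_inner_comm, InnerProductSpace.toDual_symm_apply]
  rw [h2, InnerProductSpace.toDual_symm_apply]
  refine h1.congr fun k => ?_
  rw [h2]
  rfl

lemma tendsto_clm_euclidean_of_tendsto_weakly {N : ℕ} {x : ℕ → H} {h : H}
    (hx : ∀ L : H →L[ℝ] ℝ, Tendsto (fun k => L (x k)) atTop (𝓝 (L h))) (L : H →L[ℝ] Space N) :
    Tendsto (fun k => L (x k)) atTop (𝓝 (L h)) := by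
  rw [(PiLp.homeomorph 2 _).isInducing.tendsto_nhds_iff, tendsto_pi_nhds]
  exact fun i => hx ((EuclideanSpace.proj i).comp L)

end WeakCompactness

/-! ### Almost everywhere convergence from weak convergence -/

section LocalCompactness

variable {d N : ℕ}

lemma measurable_ballAvg {ε : ℝ} (hε : 0 < ε) {u : Space d → Space N} (hu : StronglyMeasurable u) :
    Measurable (ballAvg ε u) := by
  have := isProbabilityMeasure_ballMeasure (d := d) hε
  have h : StronglyMeasurable fun z : Space d × Space d => u (z.1 + z.2) :=
    hu.comp_measurable measurable_add
  exact h.integral_prod_right'.measurable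

lemma volume_norm_sub_ballAvg_le {u : Space d → Space N} (hu : StronglyMeasurable u) {ε B η : ℝ}
    (hε : 0 < ε) (hη : 0 < η)
    (h : ∫⁻ x, ‖u x - ballAvg ε u x‖ₑ ^ 2 ≤ ENNReal.ofReal B ^ 2) (hB : 0 ≤ B) :
    volume {x | η ≤ ‖u x - ballAvg ε u x‖} ≤ ENNReal.ofReal ((B / η) ^ 2) := by
  have hm : Measurable fun x => ‖u x - ballAvg ε u x‖ₑ ^ 2 :=
    (hu.measurable.sub (measurable_ballAvg hε hu)).enorm.pow_const 2
  have h1 := meas_ge_le_lintegral_div (μ := volume) hm.aemeasurable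
    (ε := ENNReal.ofReal η ^ 2) (by simp [hη]) (by finiteness)
  have h2 : {x | η ≤ ‖u x - ballAvg ε u x‖} ⊆
      {x | ENNReal.ofReal η ^ 2 ≤ ‖u x - ballAvg ε u x‖ₑ ^ 2} := by
    intro x hx
    change ENNReal.ofReal η ^ 2 ≤ _
    rw [← ofReal_norm]
    gcongr
    exact hx
  refine (measure_mono h2).trans (h1.trans ?_)
  rw [div_pow, ENNReal.ofReal_div_of_pos (by positivity), ENNReal.ofReal_pow hB,
    ENNReal.ofReal_pow hη.le]
  gcongr

lemma TestMap.lintegral_sq_sub_ballAvg_le (φ : TestMap d N) {ε : ℝ} (hε : 0 < ε) :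
    ∫⁻ x, ‖φ.1 x - ballAvg ε φ.1 x‖ₑ ^ 2 ≤ ENNReal.ofReal (ε * (d * ‖testGrad d N φ‖)) ^ 2 := by
  refine (lintegral_sq_enorm_sub_ballAvg_le (φ.contDiff.of_le (by simp)) hε).trans ?_
  have h : ∫⁻ x, ‖fderiv ℝ φ.1 x‖ₑ ^ 2 = eLpNorm (fderiv ℝ φ.1) 2 volume ^ 2 := by
    have := eLpNorm_nnreal_pow_eq_lintegral (μ := volume) (f := fderiv ℝ φ.1) (p := 2) (by norm_num)
    simpa using this.symm
  rw [h, ENNReal.ofReal_mul hε.le, mul_pow]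
  gcongr
  exact eLpNorm_fderiv_le φ

variable [hd : Fact (3 ≤ d)]

/-- Weak convergence in `hdot` thus yields convergence of ball averages at every point. -/
lemma exists_clm_ballAvg (d N : ℕ) [hd : Fact (3 ≤ d)] (ε : ℝ) (x : Space d) :
    ∃ L : hdot d N →L[ℝ] Space N, ∀ h, L h = ballAvg ε (sobEmb d N h) x := by
  obtain ⟨L, hL⟩ := exists_clm_integral_smul (N := N) (sobExp d) (memLp_ballWeight ε x)
  exact ⟨L.comp (sobEmb d N), fun h => by
    rw [ballAvg_eq_integral, ← hL, ContinuousLinearMap.comp_apply]⟩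

lemma ballAvg_sobEmb_testToHdot (φ : TestMap d N) (ε : ℝ) (x : Space d) :
    ballAvg ε (sobEmb d N (testToHdot d N φ)) x = ballAvg ε φ.1 x := by
  rw [sobEmb_testToHdot]
  exact ballAvg_congr_ae ε (coeFn_testToLp _ φ) x

/-- Approximate by test maps: along a subsequence the values converge almost everywhere and the
averages everywhere, so Fatou's lemma carries the estimate to the limit. -/
lemma lintegral_sq_sobEmb_sub_ballAvg_le (h : hdot d N) {ε : ℝ} (hε : 0 < ε) :
    ∫⁻ x, ‖sobEmb d N h x - ballAvg ε (sobEmb d N h) x‖ₑ ^ 2 ≤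
      ENNReal.ofReal (ε * (d * ‖h‖)) ^ 2 := by
  obtain ⟨φ, hφ⟩ := exists_seq_tendsto_testToHdot h
  have hLp : Tendsto (fun n => sobEmb d N (testToHdot d N (φ n))) atTop (𝓝 (sobEmb d N h)) :=
    ((sobEmb d N).continuous.tendsto h).comp hφ
  obtain ⟨ns, hns, hae⟩ := (tendstoInMeasure_of_tendsto_Lp hLp).exists_seq_tendsto_ae
  have hae2 : ∀ᵐ x, ∀ n, sobEmb d N (testToHdot d N (φ n)) x = (φ n).1 x := by
    refine ae_all_iff.2 fun n => ?_
    rw [sobEmb_testToHdot]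
    exact coeFn_testToLp _ _
  have hlim : Tendsto (fun n => testToHdot d N (φ (ns n))) atTop (𝓝 h) := hφ.comp hns.tendsto_atTop
  set f : ℕ → Space d → ENNReal := fun n x => ‖(φ (ns n)).1 x - ballAvg ε (φ (ns n)).1 x‖ₑ ^ 2
  have hf : ∀ n, Measurable (f n) := fun n =>
    (((φ (ns n)).contDiff.continuous.measurable).sub (measurable_ballAvg hε
      (φ (ns n)).contDiff.continuous.stronglyMeasurable)).enorm.pow_const 2
  have hptw : ∀ᵐ x, Tendsto (fun n => f n x) atTop
      (𝓝 (‖sobEmb d N h x - ballAvg ε (sobEmb d N h) x‖ₑ ^ 2)) := by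
    filter_upwards [hae, hae2] with x h1 h2
    simp only [h2] at h1
    obtain ⟨L, hL⟩ := exists_clm_ballAvg d N ε x
    have h3 := (L.continuous.tendsto h).comp hlim
    simp only [Function.comp_def, hL, ballAvg_sobEmb_testToHdot] at h3
    have hc : Continuous fun a : Space N => ‖a‖ₑ ^ 2 := by fun_prop
    exact (hc.tendsto _).comp (h1.sub h3)
  calc ∫⁻ x, ‖sobEmb d N h x - ballAvg ε (sobEmb d N h) x‖ₑ ^ 2
      = ∫⁻ x, liminf (fun n => f n x) atTop := by
        refine lintegral_congr_ae ?_
        filter_upwards [hptw] with x hx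
        exact hx.liminf_eq.symm
    _ ≤ liminf (fun n => ∫⁻ x, f n x) atTop := lintegral_liminf_le hf
    _ ≤ liminf (fun n => ENNReal.ofReal (ε * (d * ‖testToHdot d N (φ (ns n))‖)) ^ 2) atTop :=
        liminf_le_liminf (Eventually.of_forall fun n => (φ (ns n)).lintegral_sq_sub_ballAvg_le hε)
    _ = ENNReal.ofReal (ε * (d * ‖h‖)) ^ 2 := by
        refine Tendsto.liminf_eq ?_
        have hc : Continuous fun h : hdot d N => ENNReal.ofReal (ε * (d * ‖h‖)) ^ 2 :=
          (ENNReal.continuous_pow 2).comp (ENNReal.continuous_ofReal.comp (by fun_prop))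
        exact (hc.tendsto h).comp hlim

/-- A finite measure dominated by, and equivalent to, Lebesgue measure. -/
lemma exists_isFiniteMeasure_le_volume (d : ℕ) :
    ∃ ν : Measure (Space d), IsFiniteMeasure ν ∧ ν ≤ volume ∧ volume ≪ ν := by
  set w : Space d → ENNReal := fun x => ENNReal.ofReal ((1 + ‖x‖) ^ (-((d : ℝ) + 1))) with hw
  have hwm : Measurable w := by fun_prop
  refine ⟨volume.withDensity w, ⟨?_⟩, ?_, ?_⟩
  · rw [withDensity_apply _ MeasurableSet.univ, Measure.restrict_univ]
    exact finite_integral_one_add_norm (by simp)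
  · have h1 : volume.withDensity w ≤ volume.withDensity 1 := by
      refine withDensity_mono (Eventually.of_forall fun x => ?_)
      rw [hw, Pi.one_apply, ENNReal.ofReal_le_one]
      exact Real.rpow_le_one_of_one_le_of_nonpos (by simp) (by linarith [(Nat.cast_nonneg d : (0 : ℝ) ≤ d)])
    rwa [withDensity_one] at h1
  · refine withDensity_absolutelyContinuous' hwm.aemeasurable (Eventually.of_forall fun x => ?_)
    have : 0 < (1 + ‖x‖) ^ (-((d : ℝ) + 1)) := by positivity
    simpa [hw] using this

/-- By Chebyshev, the deviation from the `ε`-average is small in measure uniformly in `n` once `ε`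
is small. For that fixed `ε` the averages tend to `0` pointwise, hence in measure because `ν` is
finite. -/
lemma tendstoInMeasure_sobEmb_of_tendsto_weakly_zero {ν : Measure (Space d)} [IsFiniteMeasure ν]
    (hν : ν ≤ volume) {x : ℕ → hdot d N} {M : ℝ} (hM : ∀ n, ‖x n‖ ≤ M)
    (hx : ∀ L : hdot d N →L[ℝ] ℝ, Tendsto (fun k => L (x k)) atTop (𝓝 0)) :
    TendstoInMeasure ν (fun n => (sobEmb d N (x n) : Space d → Space N)) atTop 0 := by
  have hM0 : 0 ≤ M := (norm_nonneg _).trans (hM 0)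
  have hlim : ∀ ε : ℝ, ∀ y : Space d,
      Tendsto (fun n => ballAvg ε (sobEmb d N (x n)) y) atTop (𝓝 0) := by
    intro ε y
    obtain ⟨L, hL⟩ := exists_clm_ballAvg d N ε y
    have := tendsto_clm_euclidean_of_tendsto_weakly (x := x) (h := 0) (by simpa using hx) L
    rw [map_zero] at this
    simpa only [hL] using this
  rw [tendstoInMeasure_iff_norm]
  intro η hη
  rw [ENNReal.tendsto_nhds_zero]
  intro δ hδ
  obtain ⟨δ', hδ', hδ'lt⟩ : ∃ δ' : ℝ, 0 < δ' ∧ ENNReal.ofReal δ' + ENNReal.ofReal δ' ≤ δ := by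
    rcases eq_or_ne δ ⊤ with rfl | hδt
    · exact ⟨1, one_pos, le_top⟩
    · refine ⟨δ.toReal / 2, by have := ENNReal.toReal_pos hδ.ne' hδt; positivity, ?_⟩
      rw [← ENNReal.ofReal_add (by positivity) (by positivity), add_halves,
        ENNReal.ofReal_toReal hδt]
  obtain ⟨ε, hε, hεδ⟩ : ∃ ε : ℝ, 0 < ε ∧ (ε * (d * M) / (η / 2)) ^ 2 ≤ δ' := by
    have hc : Tendsto (fun ε : ℝ => (ε * (d * M) / (η / 2)) ^ 2) (𝓝[>] 0) (𝓝 0) := by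
      have : Continuous fun ε : ℝ => (ε * (d * M) / (η / 2)) ^ 2 := by fun_prop
      simpa using (this.tendsto 0).mono_left nhdsWithin_le_nhds
    obtain ⟨ε, h1, h2⟩ := ((hc.eventually (ge_mem_nhds hδ')).and self_mem_nhdsWithin).exists
    exact ⟨ε, h2, h1⟩
  have havg : TendstoInMeasure ν (fun n => ballAvg ε (sobEmb d N (x n))) atTop 0 :=
    tendstoInMeasure_of_tendsto_ae
      (fun n => (measurable_ballAvg hε (Lp.stronglyMeasurable _)).aestronglyMeasurable)
      (Eventually.of_forall fun y => hlim ε y)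
  rw [tendstoInMeasure_iff_norm] at havg
  filter_upwards [ENNReal.tendsto_nhds_zero.1 (havg (η / 2) (by positivity)) (ENNReal.ofReal δ')
    (by simpa using hδ')] with n hn
  refine le_trans ?_ hδ'lt
  have hsub : {y | η ≤ ‖sobEmb d N (x n) y - (0 : Space d → Space N) y‖} ⊆
      {y | η / 2 ≤ ‖sobEmb d N (x n) y - ballAvg ε (sobEmb d N (x n)) y‖} ∪
      {y | η / 2 ≤ ‖ballAvg ε (sobEmb d N (x n)) y - (0 : Space d → Space N) y‖} := by
    intro y hy
    by_contra hcon
    simp only [Set.mem_union, Set.mem_ofPred_eq, not_or, not_le, Pi.zero_apply, sub_zero] at hcon hy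
    have := norm_add_le (sobEmb d N (x n) y - ballAvg ε (sobEmb d N (x n)) y)
      (ballAvg ε (sobEmb d N (x n)) y)
    rw [sub_add_cancel] at this
    linarith
  refine (measure_mono hsub).trans ((measure_union_le _ _).trans (add_le_add ?_ hn))
  refine (hν _).trans ?_
  have hB : ∫⁻ y, ‖sobEmb d N (x n) y - ballAvg ε (sobEmb d N (x n)) y‖ₑ ^ 2 ≤
      ENNReal.ofReal (ε * (d * M)) ^ 2 := by
    refine (lintegral_sq_sobEmb_sub_ballAvg_le (x n) hε).trans ?_
    gcongr
    exact hM n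
  exact (volume_norm_sub_ballAvg_le (Lp.stronglyMeasurable _) hε (by positivity) hB
    (by positivity)).trans (ENNReal.ofReal_le_ofReal hεδ)

/-- Local compactness of the Sobolev embedding, in the form of almost everywhere convergence. -/
lemma exists_subseq_tendsto_ae {x : ℕ → hdot d N} {h : hdot d N} {M : ℝ} (hM : ∀ n, ‖x n‖ ≤ M)
    (hx : ∀ L : hdot d N →L[ℝ] ℝ, Tendsto (fun k => L (x k)) atTop (𝓝 (L h))) :
    ∃ ns : ℕ → ℕ, StrictMono ns ∧
      ∀ᵐ y, Tendsto (fun k => sobEmb d N (x (ns k)) y) atTop (𝓝 (sobEmb d N h y)) := by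
  obtain ⟨ν, hνf, hν, hac⟩ := exists_isFiniteMeasure_le_volume d
  have h1 := tendstoInMeasure_sobEmb_of_tendsto_weakly_zero hν (x := fun n => x n - h)
    (M := M + ‖h‖) (fun n => (norm_sub_le _ _).trans (by gcongr; exact hM n)) (fun L => by
      simpa using (hx L).sub_const (L h))
  obtain ⟨ns, hns, hae⟩ := h1.exists_seq_tendsto_ae
  refine ⟨ns, hns, ?_⟩
  have hsub : ∀ᵐ y, ∀ n, sobEmb d N (x n - h) y = sobEmb d N (x n) y - sobEmb d N h y := by
    refine ae_all_iff.2 fun n => ?_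
    rw [map_sub]
    exact Lp.coeFn_sub _ _
  -- Lebesgue measure is absolutely continuous with respect to `ν`, so convergence `ν`-almost
  -- everywhere suffices.
  filter_upwards [hac.ae_le hae, hsub] with y h2 h3
  simp only [h3, Pi.zero_apply] at h2
  exact tendsto_sub_nhds_zero_iff.1 h2

end LocalCompactness

/-! ### Nonvanishing of the weak limit and existence of a maximizer -/

section Existence

instance (d N : ℕ) : TopologicalSpace.SeparableSpace (hdot d N) := by
  have : Fact ((2 : ENNReal) ≠ ⊤) := ⟨by norm_num⟩
  have h1 : SecondCountableTopology (Lp (Space N) 2 (volume : Measure (Space d))) :=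
    Lp.SecondCountableTopology
  have h2 : SecondCountableTopology (GradSpace d N) := PiLp.secondCountableTopology 2 _
  have h3 : SecondCountableTopology (hdot d N) := TopologicalSpace.Subtype.secondCountableTopology _
  exact TopologicalSpace.SecondCountableTopology.to_separableSpace

variable {d N : ℕ} {G : Space N → ℝ} [hd : Fact (3 ≤ d)]

/-- Test maps with normalized gradient whose energy stays away from zero have an average over
some ball of fixed radius that stays away from zero. -/
lemma SubcriticalIntegrand.exists_ballAvg_lower_bound (hG : SubcriticalIntegrand d G) {s : ℝ}
    (hs : 0 < s) :
    ∃ ε c : ℝ, 0 < c ∧ ∀ φ : TestMap d N, ‖testGrad d N φ‖ = 1 →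
      s ≤ ∫ x, G (φ.1 x) → ∃ y, c ≤ ‖ballAvg ε φ.1 y‖ := by
  have hp := critExp_pos hd.out
  obtain ⟨A, hA, hS⟩ := exists_norm_testToLp_le (N := N) hd.out
  obtain ⟨c, K, hc, hK, hGK⟩ := hG.exists_le_rpow_add (d := d) (ε := s / 2 / (A ^ critExp d + 1))
    (by positivity)
  -- With this radius, if all averages were below `c / 2`, the set `{|φ| > c}` would have volume
  -- less than `s / (2 * K)`, and the energy would stay below `s / 2 + s / 2`.
  obtain ⟨ε, hε, hεK⟩ : ∃ ε : ℝ, 0 < ε ∧ (ε * d / (c / 2)) ^ 2 < s / (2 * K) := by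
    have hcont : Tendsto (fun ε : ℝ => (ε * d / (c / 2)) ^ 2) (𝓝[>] 0) (𝓝 0) := by
      have : Continuous fun ε : ℝ => (ε * d / (c / 2)) ^ 2 := by fun_prop
      simpa using (this.tendsto 0).mono_left nhdsWithin_le_nhds
    have hsK : 0 < s / (2 * K) := by positivity
    obtain ⟨ε, h1, h2⟩ := ((hcont.eventually (gt_mem_nhds hsK)).and self_mem_nhdsWithin).exists
    exact ⟨ε, h2, h1⟩
  refine ⟨ε, c / 2, by positivity, fun φ hφ hsφ => ?_⟩
  by_contra! hcon
  set U : Set (Space d) := {x | c < ‖φ.1 x‖} with hU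
  have hφc := φ.contDiff.continuous
  have hUm : MeasurableSet U := (isOpen_lt continuous_const hφc.norm).measurableSet
  have hUle : volume U ≤ ENNReal.ofReal ((ε * d / (c / 2)) ^ 2) := by
    have h1 := φ.lintegral_sq_sub_ballAvg_le hε
    rw [hφ, mul_one] at h1
    refine (measure_mono fun x hx => ?_).trans (volume_norm_sub_ballAvg_le hφc.stronglyMeasurable
      hε (η := c / 2) (by positivity) h1 (by positivity))
    have h2 := norm_sub_norm_le (φ.1 x) (ballAvg ε φ.1 x)
    have h3 : c < ‖φ.1 x‖ := hx
    change c / 2 ≤ _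
    linarith [hcon x]
  have hUfin : volume U ≠ ⊤ := ne_top_of_le_ne_top ENNReal.ofReal_ne_top hUle
  have hUr : volume.real U ≤ (ε * d / (c / 2)) ^ 2 :=
    ENNReal.toReal_le_of_le_ofReal (by positivity) hUle
  set u := testToLp d N (sobExp d) φ
  have hu : ‖u‖ ≤ A := by simpa [hφ] using hS φ
  have hGi : Integrable (fun x => G (φ.1 x)) volume := by
    refine (hG.integrable_comp u).congr ?_
    filter_upwards [coeFn_testToLp (sobExp d) φ] with x hx
    rw [hx]
  have hui := (integrable_norm_rpow_critExp u).const_mul (s / 2 / (A ^ critExp d + 1))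
  have hUi : Integrable (U.indicator fun _ => K) volume :=
    (integrable_indicator_iff hUm).2 (integrableOn_const hUfin)
  have h1 : ∫ x, G (φ.1 x) ≤
      ∫ x, (s / 2 / (A ^ critExp d + 1) * ‖u x‖ ^ critExp d + U.indicator (fun _ => K) x) := by
    refine integral_mono_ae hGi (hui.add hUi) ?_
    filter_upwards [coeFn_testToLp (sobExp d) φ] with x hx
    rw [hx]
    exact hGK (φ.1 x)
  rw [integral_add hui hUi, integral_const_mul, integral_norm_rpow_critExp,
    integral_indicator hUm, setIntegral_const, smul_eq_mul] at h1
  have h2 : s / 2 / (A ^ critExp d + 1) * ‖u‖ ^ critExp d ≤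
      s / 2 / (A ^ critExp d + 1) * (A ^ critExp d + 1) := by
    gcongr
    exact (Real.rpow_le_rpow (norm_nonneg _) hu hp.le).trans (by simp)
  rw [div_mul_cancel₀ _ (by positivity)] at h2
  have h3 : volume.real U * K < s / (2 * K) * K := by
    gcongr
    exact hUr.trans_lt hεK
  have h4 : s / (2 * K) * K = s / 2 := by field_simp
  linarith

/-- There is a maximizing sequence with a nonzero weak limit that converges almost everywhere. -/
lemma SubcriticalIntegrand.exists_maximizing_seq_tendsto (hG : SubcriticalIntegrand d G)
    (hN : 1 ≤ N) :
    ∃ (x : ℕ → hdot d N) (h : hdot d N), h ≠ 0 ∧ (∀ n, ‖x n‖ = 1) ∧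
      Tendsto (fun n => energy G (sobEmb d N (x n))) atTop (𝓝 (testSup d G)) ∧
      (∀ L : hdot d N →L[ℝ] ℝ, Tendsto (fun n => L (x n)) atTop (𝓝 (L h))) ∧
      ∀ᵐ y, Tendsto (fun n => sobEmb d N (x n) y) atTop (𝓝 (sobEmb d N h y)) := by
  have hS := hG.testSup_pos (d := d) hN
  obtain ⟨φ, hφ1, hφS⟩ := hG.exists_maximizing_seq (d := d) hN
  obtain ⟨ε, c, hc, hlow⟩ := hG.exists_ballAvg_lower_bound (d := d) (half_pos hS)
  -- Beyond index `n₀` the energy exceeds half the supremum, so the lower bound on averages applies.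
  obtain ⟨n₀, hn₀⟩ := eventually_atTop.1 (hφS.eventually (lt_mem_nhds (half_lt_self hS)))
  have hy := fun n => hlow (φ (n + n₀)) (hφ1 _) (hn₀ _ (Nat.le_add_left _ _)).le
  choose y hy using hy
  set ψ : ℕ → TestMap d N := fun n => (φ (n + n₀)).translate (y n)
  have hψ1 : ∀ n, ‖testToHdot d N (ψ n)‖ = 1 := fun n => by
    rw [norm_testToHdot, norm_testGrad_translate, hφ1]
  have hψS : Tendsto (fun n => energy G (sobEmb d N (testToHdot d N (ψ n)))) atTop
      (𝓝 (testSup d G)) := by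
    refine ((tendsto_add_atTop_iff_nat n₀).2 hφS).congr fun n => ?_
    rw [sobEmb_testToHdot, energy_testToLp]
    exact (integral_add_right_eq_self (μ := volume) (fun x => G ((φ (n + n₀)).1 x)) (y n)).symm
  have hψavg : ∀ n, c ≤ ‖ballAvg ε (sobEmb d N (testToHdot d N (ψ n))) 0‖ := fun n => by
    rw [ballAvg_sobEmb_testToHdot]
    have := ballAvg_translate ε (φ (n + n₀)).1 0 (y n)
    rw [zero_add] at this
    exact (hy n).trans_eq (congrArg _ this.symm)
  obtain ⟨h, ns, hns, hweak⟩ := exists_subseq_tendsto_weakly (fun n => (hψ1 n).le)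
  obtain ⟨ms, hms, hae⟩ := exists_subseq_tendsto_ae (fun n => (hψ1 (ns n)).le) hweak
  refine ⟨fun n => testToHdot d N (ψ (ns (ms n))), h, ?_, fun n => hψ1 _,
    hψS.comp (hns.comp hms).tendsto_atTop, fun L => (hweak L).comp hms.tendsto_atTop, hae⟩
  -- The average at the origin is weakly continuous, so a zero limit would contradict its lower
  -- bound `c`.
  rintro rfl
  obtain ⟨L, hL⟩ := exists_clm_ballAvg d N ε 0
  have hlim := (tendsto_clm_euclidean_of_tendsto_weakly hweak L).norm
  rw [L.map_zero, norm_zero] at hlim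
  have := ge_of_tendsto' hlim fun n => (hψavg (ns n)).trans_eq (by rw [hL])
  linarith

/-- The supremum is attained in the homogeneous Sobolev space. -/
lemma SubcriticalIntegrand.exists_maximizer (hG : SubcriticalIntegrand d G) (hN : 1 ≤ N) :
    ∃ h : hdot d N, ‖h‖ = 1 ∧ energy G (sobEmb d N h) = testSup d G := by
  have hS := hG.testSup_pos (d := d) hN
  obtain ⟨x, h, hh, hx1, hxS, hweak, hae⟩ := hG.exists_maximizing_seq_tendsto (d := d) hN
  have hp2 := two_lt_critExp hd.out
  set p := critExp d
  have hp : 0 < p := by linarith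
  have hsq : Tendsto (fun n => ‖x n - h‖ ^ 2) atTop (𝓝 (1 - ‖h‖ ^ 2)) := by
    have h1 := hweak (innerSL ℝ h)
    simp only [innerSL_apply_apply, real_inner_self_eq_norm_sq] at h1
    have h2 := ((h1.const_mul 2).const_sub 1).add_const (‖h‖ ^ 2)
    rw [show 1 - 2 * ‖h‖ ^ 2 + ‖h‖ ^ 2 = 1 - ‖h‖ ^ 2 by ring] at h2
    refine h2.congr fun n => ?_
    rw [norm_sub_sq_real, hx1, real_inner_comm, one_pow]
  have hm1 : 0 ≤ 1 - ‖h‖ ^ 2 := ge_of_tendsto' hsq fun n => by positivity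
  have hm0 : 0 < ‖h‖ ^ 2 := by have := norm_pos_iff.2 hh; positivity
  have hpow : ∀ t : ℝ, 0 ≤ t → t ^ p = (t ^ 2) ^ (p / 2) := fun t ht => by
    rw [← Real.rpow_natCast, ← Real.rpow_mul ht]
    congr 1
    push_cast
    ring
  have hrem : Tendsto (fun n => ‖x n - h‖ ^ p) atTop (𝓝 ((1 - ‖h‖ ^ 2) ^ (p / 2))) := by
    simp_rw [hpow _ (norm_nonneg _)]
    exact hsq.rpow_const (Or.inr (by positivity))
  have hbound : ∀ n, ‖sobEmb d N (x n)‖ ≤ ‖sobEmb d N‖ := fun n => by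
    simpa [hx1] using (sobEmb d N).le_opNorm (x n)
  have hBL := hG.tendsto_energy_sub_energy_sub hbound hae
  have hle : testSup d G ≤
      energy G (sobEmb d N h) + testSup d G * (1 - ‖h‖ ^ 2) ^ (p / 2) := by
    have h1 := hBL.add (hrem.const_mul (testSup d G))
    refine le_of_tendsto_of_tendsto' hxS h1 fun n => ?_
    have := hG.energy_sobEmb_le (x n - h)
    rw [map_sub] at this
    linarith
  have hh_le := hG.energy_sobEmb_le h
  rw [hpow _ (norm_nonneg _)] at hh_le
  have hm : ‖h‖ ^ 2 = 1 := by
    by_contra hne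
    have hlt : ‖h‖ ^ 2 < 1 := lt_of_le_of_ne (by linarith) hne
    have h1 : (‖h‖ ^ 2) ^ (p / 2) < ‖h‖ ^ 2 :=
      Real.rpow_lt_self_of_lt_one hm0 hlt (by linarith)
    have h2 : (1 - ‖h‖ ^ 2) ^ (p / 2) < 1 - ‖h‖ ^ 2 :=
      Real.rpow_lt_self_of_lt_one (by linarith) (by linarith) (by linarith)
    -- For `0 < m < 1` the two strict inequalities sum to `m^(p/2) + (1-m)^(p/2) < 1`, so the
    -- splitting would give `S < S`.
    nlinarith
  refine ⟨h, by rwa [← sq_eq_sq₀ (norm_nonneg _) zero_le_one, one_pow], ?_⟩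
  rw [hm, sub_self, Real.zero_rpow (by positivity), mul_zero, add_zero] at hle
  rw [hm, Real.one_rpow, mul_one] at hh_le
  exact le_antisymm hh_le hle

end Existence

theorem mainTheorem10 (d N : ℕ) (hd : 3 ≤ d) (hN : 1 ≤ N)
    (G : EuclideanSpace ℝ (Fin N) → ℝ) (hG : Continuous G)
    (hpos : ∀ a, a ≠ 0 → 0 < G a) (hzero : G 0 = 0)
    (hlim_zero : Tendsto (fun a => ‖a‖ ^ (-critExp d) * G a) (𝓝[≠] 0) (𝓝 0))
    (hlim_infty : Tendsto (fun a => ‖a‖ ^ (-critExp d) * G a)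
      (Bornology.cobounded (EuclideanSpace ℝ (Fin N))) (𝓝 0))
    (hincr : ∀ δ : ℝ, 0 < δ → ∃ C : ℝ, 0 < C ∧ ∀ a b : EuclideanSpace ℝ (Fin N),
      |G (a + b) - G a| ≤ δ * ‖a‖ ^ critExp d + C * ‖b‖ ^ critExp d) :
    ∃ u ∈ constraintSet d G, ((∫ x, G (u x) : ℝ) : EReal) = supValue d G := by
  have : Fact (3 ≤ d) := ⟨hd⟩
  have hS : SubcriticalIntegrand d G := ⟨hG, hpos, hzero, hlim_zero, hlim_infty, hincr⟩
  obtain ⟨h, hh, hmax⟩ := hS.exists_maximizer hN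
  have hmem : (sobEmb d N h : Space d → Space N) ∈ constraintSet d G :=
    ⟨hS.integrable_comp _, _, memHomogeneousSobolev_sobEmb h, (gradNorm_gradSpace h.1).trans hh⟩
  refine ⟨sobEmb d N h, hmem, le_antisymm ?_ ?_⟩
  · exact le_iSup₂_of_le (sobEmb d N h : Space d → Space N) hmem le_rfl
  · refine iSup₂_le fun u hu => ?_
    obtain ⟨-, g, hug, hg⟩ := hu
    -- Every competitor comes from `hdot`, so the bound by the supremum over test maps covers it.
    obtain ⟨k, hk, hku⟩ := hug.exists_hdot
    have h1 : ∫ x, G (u x) = energy G (sobEmb d N k) := by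
      refine integral_congr_ae ?_
      filter_upwards [hku] with x hx
      rw [hx]
    have h2 := hS.energy_sobEmb_le k
    rw [hk, hg, Real.one_rpow, mul_one, ← h1, ← hmax] at h2
    exact EReal.coe_le_coe_iff.2 h2
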